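/- **Theorem (Equivalence for affine $\Gamma$-schemes).** Let $\Gamma$ be a non-empty set and $T$ a commutative ternary $\Gamma$-semiring with identity: a commutative monoid $(T,+,0)$ with operations $(a,b,c)\mapsto\{a,b,c\}_\gamma$ $(\gamma\in\Gamma)$, additive in each variable, such that $\{a,b,\{c,d,e\}_\gamma\}_\delta=\{\{a,b,c\}_\gamma,d,e\}_\delta$, $\{a,0,b\}_\gamma=0$, $\{a,b,c\}_\gamma=\{b,a,c\}_\gamma$, and an element $1\in T$ with $\{1,1,a\}_\gamma=\{1,a,1\}_\gamma=\{a,1,1\}_\gamma=a$ for all $a,\gamma$. A $\Gamma$-module over $T$ is a commutative monoid $(M,+,0)$ with an action $\{-,-,-\}_\gamma:T\times T\times M\to M$, additive in each variable and equal to $0$ if one of the arguments is $0$, such that $\{a,b,\{c,d,m\}_\gamma\}_\delta=\{\{a,b,c\}_\gamma,d,m\}_\delta$ and $\{1,1,m\}_\gamma=m$; morphisms are the additive maps that commute with the action. A $\Gamma$-ideal is a subset containing $0$, closed under $+$, and containing $\{a,b,c\}_\gamma$ as soon as it contains one of $a,b,c$; $\mathrm{Spec}_\Gamma(T)$ is the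 set of $\Gamma$-ideals $P\neq T$ such that $\{a,b,c\}_\gamma\in P$ implies $a\in P$, $b\in P$ or $c\in P$, with the closed sets $V(I)=\{P\mid I\subseteq P\}$. For a multiplicative system $S\ni 1$ (closed under all $\{-,-,-\}_\gamma$), $S^{-1}M$ is the set of fractions $m/s$, where $m/s=n/t$ iff there is $u\in S$ with $\{u,t,m\}_\gamma=\{u,s,n\}_\gamma$ for all $\gamma$, with $m/s+n/t=(\{t,t,m\}_\gamma+\{s,t,n\}_\gamma)/\{s,t,t\}_\gamma$ (independent of $\gamma$) and $\{a/s,b/t,m/u\}_\gamma=\{a,b,m\}_\gamma/\{s,t,u\}_\gamma$. Put $M_P=(T\setminus P)^{-1}M$, and let $M_a$ be the localization of $M$ at the powers of $a\in T$. The structure sheaf $\mathcal O$ on $\mathrm{Spec}_\Gamma(T)$ has as sections over $U$ the functions $s$ on $U$ with $s(P)\in T_P$ that are locally of the form $Q\mapsto a/b$ with fixed $a,b\in T$, $b\notin Q$. A $\Gamma$-sheaf is a sheaf of $\Gamma$-modules over $\mathcal O$; morphisms are families of $\mathcal O(U)$-linear maps compatible with restrictions. For a $\Gamma$-module $M$ over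 $T$, $\widetilde M$ is the sheafification of $D(a)=\{P\mid a\notin P\}\mapsto M_a$: its sections over $U$ are the functions $s$ on $U$ with $s(P)\in M_P$ that are locally given by the images of an element of some $M_a$. A $\Gamma$-sheaf is quasi-coherent if every point of $\mathrm{Spec}_\Gamma(T)$ has an open neighbourhood over which it is isomorphic to $\widetilde M$ for some $\Gamma$-module $M$ over $T$. Then the functor $$\Phi:\mathbf{Mod}_T\longrightarrow\mathbf{QCoh}(\mathrm{Spec}_\Gamma(T)),\qquad M\longmapsto\widetilde M,$$ is an equivalence of categories between $\Gamma$-modules over $T$ and quasi-coherent $\Gamma$-sheaves on $\mathrm{Spec}_\Gamma(T)$. -/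

import Mathlib

open CategoryTheory TopologicalSpace Opposite

universe u v w

noncomputable section

namespace GammaGeometry

/-! ### Ternary `Γ`-semirings and `Γ`-modules -/

/-- A ternary `Γ`-semiring: an additive commutative monoid `T` with a ternary operation
`{a, b, c}_γ = tri γ a b c`. -/
class TernaryGammaSemiring (Γ : Type w) (T : Type u) [AddCommMonoid T] where
  tri : Γ → T → T → T → T
  tri_add_left : ∀ γ a b c d, tri γ (a + b) c d = tri γ a c d + tri γ b c d
  tri_add_mid : ∀ γ a b c d, tri γ a (b + c) d = tri γ a b d + tri γ a c d
  tri_add_right : ∀ γ a b c d, tri γ a b (c + d) = tri γ a b c + tri γ a b d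
  tri_assoc : ∀ γ δ a b c d e, tri δ a b (tri γ c d e) = tri δ (tri γ a b c) d e
  tri_zero_mid : ∀ γ a b, tri γ a 0 b = 0

/-- A commutative ternary `Γ`-semiring with identity element `1`. -/
class CommTernaryGammaSemiring (Γ : Type w) (T : Type u) [AddCommMonoid T] [One T] extends
    TernaryGammaSemiring Γ T where
  tri_comm : ∀ γ a b c, tri γ a b c = tri γ b a c
  tri_one_one : ∀ γ a, tri γ 1 1 a = a
  one_tri_one : ∀ γ a, tri γ 1 a 1 = a
  one_one_tri : ∀ γ a, tri γ a 1 1 = a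

/-- A (left, unitary) `Γ`-module over `T`: an additive commutative monoid `M` with a ternary
action `{a, b, m}_γ = act γ a b m`. -/
class GammaModule (Γ : Type w) (T : Type u) (M : Type v) [AddCommMonoid T] [One T]
    [CommTernaryGammaSemiring Γ T] [AddCommMonoid M] where
  act : Γ → T → T → M → M
  act_add_left : ∀ γ a a' b m, act γ (a + a') b m = act γ a b m + act γ a' b m
  act_add_mid : ∀ γ a b b' m, act γ a (b + b') m = act γ a b m + act γ a b' m
  act_add_right : ∀ γ a b m m', act γ a b (m + m') = act γ a b m + act γ a b m'
  act_assoc : ∀ γ δ a b c d m,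
    act δ a b (act γ c d m) = act δ (TernaryGammaSemiring.tri γ a b c) d m
  act_zero_left : ∀ γ b m, act γ 0 b m = 0
  act_zero_mid : ∀ γ a m, act γ a 0 m = 0
  act_zero_right : ∀ γ a b, act γ a b 0 = 0
  act_one_one : ∀ γ m, act γ 1 1 m = m

open TernaryGammaSemiring CommTernaryGammaSemiring GammaModule

section Basic

variable {Γ : Type w} {T : Type u} [AddCommMonoid T] [One T] [CommTernaryGammaSemiring Γ T]

theorem tri_one_mid (γ : Γ) (a b : T) : tri γ a 1 b = tri γ a b 1 := by
  have h := tri_assoc (T := T) γ γ a 1 1 b 1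
  rwa [one_tri_one, one_one_tri] at h

theorem tri_eq (γ δ : Γ) (a b c : T) : tri γ a b c = tri δ (tri δ a b 1) c 1 := by
  have h1 : ∀ (δ γ : Γ) (a b x : T), tri δ a b x = tri δ (tri γ a b 1) 1 x := by
    intro δ γ a b x
    rw [← tri_assoc, tri_one_one]
  have h2 : ∀ (δ γ : Γ) (a b : T), tri δ a b 1 = tri γ a b 1 := by
    intro δ γ a b
    rw [h1 δ γ a b 1, one_one_tri]
  rw [h1 γ δ, tri_one_mid, h2 γ δ]

/-- Auxiliary: with an identity present, `a * b = {a, b, 1}_γ` is a commutative semiring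
structure. It is only used to verify identities. -/
abbrev auxCommSemiring (γ : Γ) : CommSemiring T :=
  { (inferInstance : AddCommMonoid T), (inferInstance : One T) with
    mul := fun a b => tri γ a b 1
    left_distrib := fun a b c => tri_add_mid γ a b c 1
    right_distrib := fun a b c => tri_add_left γ a b c 1
    zero_mul := fun a => (tri_comm γ 0 a 1).trans (tri_zero_mid γ a 1)
    mul_zero := fun a => tri_zero_mid γ a 1
    mul_assoc := fun a b c => by
      change tri γ (tri γ a b 1) c 1 = tri γ a (tri γ b c 1) 1
      rw [← tri_one_mid γ a (tri γ b c 1), tri_assoc, tri_one_mid]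
    one_mul := fun a => one_tri_one γ a
    mul_one := fun a => one_one_tri γ a
    mul_comm := fun a b => tri_comm γ a b 1 }

theorem tri_eq_mul (γ δ : Γ) (a b c : T) :
    letI := auxCommSemiring (T := T) δ
    tri γ a b c = a * b * c :=
  tri_eq γ δ a b c

/-- `T` is a `Γ`-module over itself. -/
instance selfModule : GammaModule Γ T T where
  act := tri
  act_add_left γ a a' b m := tri_add_left γ a a' b m
  act_add_mid := tri_add_mid
  act_add_right := tri_add_right
  act_assoc := tri_assoc
  act_zero_left γ b m := (tri_comm γ 0 b m).trans (tri_zero_mid γ b m)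
  act_zero_mid := tri_zero_mid
  act_zero_right γ a b := by
    let _ := auxCommSemiring (T := T) γ
    rw [tri_eq_mul γ γ, mul_zero]
  act_one_one := tri_one_one

theorem act_self (γ : Γ) (a b c : T) : act γ a b c = tri γ a b c := rfl

variable {M : Type v} [AddCommMonoid M] [GammaModule Γ T M]

theorem act_eq (γ δ : Γ) (a b : T) (m : M) : act γ a b m = act δ (tri δ a b 1) 1 m := by
  have h : ∀ x : T, act γ x 1 m = act δ x 1 m := by
    intro x
    rw [← act_one_one (T := T) δ (act γ x 1 m), act_assoc, tri_one_one]
  rw [← h, ← act_assoc, act_one_one]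

variable (M) in
/-- Auxiliary: the module over `auxCommSemiring`. -/
abbrev auxModule (γ : Γ) :
    letI := auxCommSemiring (T := T) γ
    Module T M :=
  letI := auxCommSemiring (T := T) γ
  { smul := fun a m => act γ a 1 m
    one_smul := fun m => act_one_one γ m
    mul_smul := fun a b m => by
      change act γ (tri γ a b 1) 1 m = act γ a 1 (act γ b 1 m)
      rw [act_assoc, tri_one_mid]
    smul_zero := fun a => act_zero_right γ a 1
    smul_add := fun a m n => act_add_right γ a 1 m n
    add_smul := fun a b m => act_add_left γ a b 1 m
    zero_smul := fun m => act_zero_left γ 1 m }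

theorem act_eq_smul (γ δ : Γ) (a b : T) (m : M) :
    letI := auxCommSemiring (T := T) δ
    letI := auxModule (T := T) M δ
    act γ a b m = (a * b) • m :=
  act_eq γ δ a b m

end Basic

/-! ### Prime ideals and the spectrum -/

/-- A `Γ`-ideal of `T`. -/
structure GammaIdeal (Γ : Type w) (T : Type u) [AddCommMonoid T] [TernaryGammaSemiring Γ T] where
  carrier : Set T
  zero_mem : (0 : T) ∈ carrier
  add_mem : ∀ a b, a ∈ carrier → b ∈ carrier → a + b ∈ carrier
  tri_mem_left : ∀ (γ : Γ) a b c, a ∈ carrier → tri γ a b c ∈ carrier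
  tri_mem_mid : ∀ (γ : Γ) a b c, a ∈ carrier → tri γ c a b ∈ carrier
  tri_mem_right : ∀ (γ : Γ) a b c, a ∈ carrier → tri γ b c a ∈ carrier

/-- The set of prime `Γ`-ideals of `T`. -/
structure Spec (Γ : Type w) (T : Type u) [AddCommMonoid T] [TernaryGammaSemiring Γ T] extends
    GammaIdeal Γ T where
  ne_univ : carrier ≠ Set.univ
  prime : ∀ (γ : Γ) a b c, tri γ a b c ∈ carrier → a ∈ carrier ∨ b ∈ carrier ∨ c ∈ carrier

namespace Spec

section Topology

variable {Γ : Type w} {T : Type u} [AddCommMonoid T] [TernaryGammaSemiring Γ T]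

/-- `V(I)`, the set of prime ideals containing `I`. -/
def zeroLocus (I : GammaIdeal Γ T) : Set (Spec Γ T) :=
  {P | I.carrier ⊆ P.carrier}

/-- The Zariski-type topology: the closed sets are the `V(I)`, for `I` a `Γ`-ideal. -/
instance [Nonempty Γ] : TopologicalSpace (Spec Γ T) :=
  TopologicalSpace.ofClosed {Z | ∃ I : GammaIdeal Γ T, Z = zeroLocus I}
    ⟨⟨Set.univ, trivial, fun _ _ _ _ => trivial, fun _ _ _ _ _ => trivial,
        fun _ _ _ _ _ => trivial, fun _ _ _ _ _ => trivial⟩, by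
      ext P
      simpa [zeroLocus] using P.ne_univ⟩
    (by
      intro A hA
      refine ⟨⟨{a | ∀ J : GammaIdeal Γ T,
          (∀ I : GammaIdeal Γ T, zeroLocus I ∈ A → I.carrier ⊆ J.carrier) → a ∈ J.carrier},
        fun J _ => J.zero_mem, fun a b ha hb J hJ => J.add_mem a b (ha J hJ) (hb J hJ),
        fun γ a b c ha J hJ => J.tri_mem_left γ a b c (ha J hJ),
        fun γ a b c ha J hJ => J.tri_mem_mid γ a b c (ha J hJ),
        fun γ a b c ha J hJ => J.tri_mem_right γ a b c (ha J hJ)⟩, ?_⟩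
      ext P
      constructor
      · intro hP a ha
        exact ha P.toGammaIdeal fun I hI => Set.mem_sInter.1 hP _ hI
      · intro hP Z hZ
        obtain ⟨I, rfl⟩ := hA hZ
        exact fun a ha => hP fun J hJ => hJ I hZ ha)
    (by
      rintro _ ⟨I, rfl⟩ _ ⟨J, rfl⟩
      refine ⟨⟨I.carrier ∩ J.carrier, ⟨I.zero_mem, J.zero_mem⟩,
        fun a b ha hb => ⟨I.add_mem a b ha.1 hb.1, J.add_mem a b ha.2 hb.2⟩,
        fun γ a b c ha => ⟨I.tri_mem_left γ a b c ha.1, J.tri_mem_left γ a b c ha.2⟩,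
        fun γ a b c ha => ⟨I.tri_mem_mid γ a b c ha.1, J.tri_mem_mid γ a b c ha.2⟩,
        fun γ a b c ha => ⟨I.tri_mem_right γ a b c ha.1, J.tri_mem_right γ a b c ha.2⟩⟩, ?_⟩
      ext P
      constructor
      · rintro (h | h) a ha
        · exact h ha.1
        · exact h ha.2
      · intro h
        by_contra hc
        rw [Set.mem_union, not_or] at hc
        obtain ⟨a, ha, haP⟩ := Set.not_subset.1 hc.1
        obtain ⟨b, hb, hbP⟩ := Set.not_subset.1 hc.2
        have γ : Γ := Classical.arbitrary Γ
        rcases P.prime γ a a b (h ⟨I.tri_mem_left γ a a b ha, J.tri_mem_right γ b a a hb⟩) with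
          h | h | h
        · exact haP h
        · exact haP h
        · exact hbP h)

end Topology

end Spec

/-! ### Localization -/

/-- A multiplicative system in `T`. (That `0` is not a member is not part of the definition, so that
the powers of a nilpotent element form one, too.) -/
structure MulSystem (Γ : Type w) (T : Type u) [AddCommMonoid T] [One T]
    [TernaryGammaSemiring Γ T] where
  carrier : Set T
  one_mem : (1 : T) ∈ carrier
  tri_mem : ∀ (γ : Γ) a b c, a ∈ carrier → b ∈ carrier → c ∈ carrier → tri γ a b c ∈ carrier

section Systems

variable {Γ : Type w} {T : Type u} [AddCommMonoid T] [One T] [CommTernaryGammaSemiring Γ T]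

theorem Spec.one_notMem [Nonempty Γ] (P : Spec Γ T) : (1 : T) ∉ P.carrier := by
  intro h
  refine P.ne_univ (Set.eq_univ_of_forall fun a => ?_)
  have γ : Γ := Classical.arbitrary Γ
  rw [← tri_one_one γ a]
  exact P.tri_mem_left γ 1 1 a h

/-- `S_P = T \ P`. -/
def Spec.primeCompl [Nonempty Γ] (P : Spec Γ T) : MulSystem Γ T where
  carrier := {a | a ∉ P.carrier}
  one_mem := P.one_notMem
  tri_mem γ a b c ha hb hc h := by
    rcases P.prime γ a b c h with h | h | h
    · exact ha h
    · exact hb h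
    · exact hc h

variable (Γ) in
/-- `IsPower Γ a x` says that `x` is one of the powers `1, a, {a, a, 1}, {a, a, a}, …` of `a`. -/
inductive IsPower (a : T) : T → Prop
  | one : IsPower a 1
  | self : IsPower a a
  | tri (γ : Γ) (x y z : T) : IsPower a x → IsPower a y → IsPower a z →
      IsPower a (TernaryGammaSemiring.tri γ x y z)

variable (Γ) in
/-- `S_a = {aⁿ | n ≥ 0}`, the multiplicative system generated by `a`. -/
def powers (a : T) : MulSystem Γ T where
  carrier := {x | IsPower Γ a x}
  one_mem := .one
  tri_mem γ x y z hx hy hz := .tri γ x y z hx hy hz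

theorem powers_subset {a : T} {S : MulSystem Γ T} (ha : a ∈ S.carrier) :
    (powers Γ a).carrier ⊆ S.carrier := by
  intro x hx
  induction hx with
  | one => exact S.one_mem
  | self => exact ha
  | tri γ x y z _ _ _ h₁ h₂ h₃ => exact S.tri_mem γ x y z h₁ h₂ h₃

end Systems

section Localization

variable {Γ : Type w} [Nonempty Γ] {T : Type u} [AddCommMonoid T] [One T]
  [CommTernaryGammaSemiring Γ T]

theorem smul_aux {R : Type u} {M : Type v} [CommSemiring R] [AddCommMonoid M] [Module R M]
    {a b c e : R} {m n : M} (h : a • m = b • n) (d : R) (hc : c = d * a) (he : e = d * b) :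
    c • m = e • n := by
  rw [hc, he, mul_smul, h, ← mul_smul]

/-- The relation on fractions: `(m, s) ∼ (n, t)` if there is `u ∈ S` with
`{u, t, m}_γ = {u, s, n}_γ` for all `γ`. -/
def locSetoid (S : MulSystem Γ T) (M : Type v) [AddCommMonoid M] [GammaModule Γ T M] :
    Setoid (M × S.carrier) where
  r p q := ∃ u ∈ S.carrier, ∀ γ : Γ, act γ u (q.2 : T) p.1 = act γ u (p.2 : T) q.1
  iseqv := by
    refine ⟨fun p => ⟨1, S.one_mem, fun _ => rfl⟩, ?_, ?_⟩
    · rintro p q ⟨u, hu, h⟩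
      exact ⟨u, hu, fun γ => (h γ).symm⟩
    · rintro ⟨m, s⟩ ⟨n, t, ht⟩ ⟨k, r⟩ ⟨u, hu, h⟩ ⟨v, hv, h'⟩
      let γ₀ : Γ := Classical.arbitrary Γ
      refine ⟨tri γ₀ u v t, S.tri_mem γ₀ u v t hu hv ht, fun γ => ?_⟩
      let _ := auxCommSemiring (T := T) γ₀
      let _ := auxModule (T := T) M γ₀
      have h := h γ₀
      have h' := h' γ₀
      simp only [act_eq_smul _ γ₀, tri_eq_mul _ γ₀] at h h' ⊢
      rw [smul_aux h (v * (r : T)) (e := u * v * s * r) (by ring) (by ring)]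
      exact smul_aux h' (u * (s : T)) (by ring) (by ring)

/-- The localization `S⁻¹M`. -/
def Loc (S : MulSystem Γ T) (M : Type v) [AddCommMonoid M] [GammaModule Γ T M] : Type (max u v) :=
  Quotient (locSetoid S M)

namespace Loc

variable {S : MulSystem Γ T} {M : Type v} [AddCommMonoid M] [GammaModule Γ T M]

/-- The fraction `m / s`. -/
def mk (m : M) (s : S.carrier) : Loc S M :=
  Quotient.mk (locSetoid S M) (m, s)

theorem mk_eq {m n : M} {s t : S.carrier} :
    (mk m s : Loc S M) = mk n t ↔
      ∃ u ∈ S.carrier, ∀ γ : Γ, act γ u (t : T) m = act γ u (s : T) n :=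
  ⟨fun h => Quotient.exact h, fun h => Quotient.sound h⟩

theorem ind {p : Loc S M → Prop} (h : ∀ m s, p (mk m s)) (x : Loc S M) : p x :=
  Quotient.ind (fun q => h q.1 q.2) x

/-- The denominator `{s, t, u}_γ`. -/
def den (γ : Γ) (s t u : S.carrier) : S.carrier :=
  ⟨tri γ (s : T) (t : T) (u : T), S.tri_mem γ _ _ _ s.2 t.2 u.2⟩

/-- `m / s + n / t = ({t, t, m}_γ + {s, t, n}_γ) / {s, t, t}_γ`; see `mk_add_mk` for the
independence of `γ`. -/
instance : Add (Loc S M) where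
  add := Quotient.map₂ (fun p q =>
      (act (Classical.arbitrary Γ) (q.2 : T) (q.2 : T) p.1 +
        act (Classical.arbitrary Γ) (p.2 : T) (q.2 : T) q.1,
      den (Classical.arbitrary Γ) p.2 q.2 q.2)) (by
    rintro ⟨m, s⟩ ⟨m', s'⟩ ⟨u, hu, h⟩ ⟨n, t⟩ ⟨n', t'⟩ ⟨v, hv, h'⟩
    let γ₀ : Γ := Classical.arbitrary Γ
    refine ⟨tri γ₀ u v 1, S.tri_mem γ₀ u v 1 hu hv S.one_mem, fun γ => ?_⟩
    let _ := auxCommSemiring (T := T) γ₀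
    let _ := auxModule (T := T) M γ₀
    have h := h γ₀
    have h' := h' γ₀
    simp only [act_eq_smul _ γ₀, tri_eq_mul _ γ₀, den] at h h' ⊢
    simp only [smul_add, smul_smul]
    congr 1
    · exact smul_aux h (v * t * t * t' * t') (by ring) (by ring)
    · exact smul_aux h' (u * s' * t' * s * t) (by ring) (by ring))

/-- The action `{a / s, b / t, m / u}_γ = {a, b, m}_γ / {s, t, u}_γ` of `S⁻¹T` on `S⁻¹M`. -/
def locAct (γ : Γ) (x y : Loc S T) (z : Loc S M) : Loc S M :=
  Quotient.liftOn₂ x y (fun p q => Quotient.map (sa := locSetoid S M) (sb := locSetoid S M)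
      (fun r => (act γ p.1 q.1 r.1, den γ p.2 q.2 r.2)) (by
    rintro ⟨m, s⟩ ⟨m', s'⟩ ⟨u, hu, h⟩
    refine ⟨u, hu, fun δ => ?_⟩
    let _ := auxCommSemiring (T := T) γ
    let _ := auxModule (T := T) M γ
    have h := h γ
    simp only [act_eq_smul _ γ, tri_eq_mul _ γ, den, smul_smul] at h ⊢
    exact smul_aux h (p.2 * q.2 * p.1 * q.1) (by ring) (by ring)) z) (by
    rintro ⟨a, s⟩ ⟨b, t⟩ ⟨a', s'⟩ ⟨b', t'⟩ ⟨u, hu, h⟩ ⟨v, hv, h'⟩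
    induction z using Quotient.ind with | _ r
    obtain ⟨m, r⟩ := r
    refine Quotient.sound ⟨tri γ u v 1, S.tri_mem γ u v 1 hu hv S.one_mem, fun δ => ?_⟩
    let _ := auxCommSemiring (T := T) γ
    let _ := auxModule (T := T) M γ
    have h : u * s' * a = u * s * a' := by
      have h := h γ
      change tri γ _ _ _ = tri γ _ _ _ at h
      simpa only [tri_eq_mul _ γ] using h
    have h' : v * t' * b = v * t * b' := by
      have h' := h' γ
      change tri γ _ _ _ = tri γ _ _ _ at h'
      simpa only [tri_eq_mul _ γ] using h'
    simp only [act_eq_smul _ γ, tri_eq_mul _ γ, den, smul_smul]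
    congr 1
    calc u * v * 1 * (s' * t' * r) * (a * b) = (u * s' * a) * (v * t' * b) * r := by ring
      _ = _ := by rw [h, h']; ring)

theorem mk_add_mk (γ : Γ) (m n : M) (s t : S.carrier) :
    (mk m s + mk n t : Loc S M) =
      mk (act γ (t : T) (t : T) m + act γ (s : T) (t : T) n) (den γ s t t) := by
  refine Quotient.sound ⟨1, S.one_mem, fun δ => ?_⟩
  let _ := auxCommSemiring (T := T) γ
  let _ := auxModule (T := T) M γ
  simp only [act_eq_smul _ γ, tri_eq_mul _ γ, den]

theorem locAct_mk (γ : Γ) (a b : T) (m : M) (s t u : S.carrier) :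
    locAct γ (mk a s : Loc S T) (mk b t) (mk m u : Loc S M) = mk (act γ a b m) (den γ s t u) :=
  rfl

/-- A criterion for the equality of fractions. -/
theorem mk_eq_mk {m n : M} {s t : S.carrier} (γ : Γ)
    (h : letI := auxCommSemiring (T := T) γ
      letI := auxModule (T := T) M γ
      (t : T) • m = (s : T) • n) : (mk m s : Loc S M) = mk n t := by
  refine mk_eq.2 ⟨1, S.one_mem, fun δ => ?_⟩
  let _ := auxCommSemiring (T := T) γ
  let _ := auxModule (T := T) M γ
  simp only [act_eq_smul _ γ, one_mul]
  exact h

instance : Zero (Loc S M) where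
  zero := mk 0 ⟨1, S.one_mem⟩

theorem zero_def : (0 : Loc S M) = mk 0 ⟨1, S.one_mem⟩ := rfl

instance : AddCommMonoid (Loc S M) where
  add_assoc x y z := by
    induction x using Loc.ind with | _ m s
    induction y using Loc.ind with | _ n t
    induction z using Loc.ind with | _ k r
    let γ : Γ := Classical.arbitrary Γ
    simp only [mk_add_mk γ]
    refine mk_eq_mk γ ?_
    let _ := auxCommSemiring (T := T) γ
    let _ := auxModule (T := T) M γ
    simp only [act_eq_smul _ γ, tri_eq_mul _ γ, den]
    match_scalars <;> ring
  zero_add x := by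
    induction x using Loc.ind with | _ m s
    let γ : Γ := Classical.arbitrary Γ
    rw [zero_def, mk_add_mk γ]
    refine mk_eq_mk γ ?_
    let _ := auxCommSemiring (T := T) γ
    let _ := auxModule (T := T) M γ
    simp only [act_eq_smul _ γ, tri_eq_mul _ γ, den]
    match_scalars
    ring
  add_zero x := by
    induction x using Loc.ind with | _ m s
    let γ : Γ := Classical.arbitrary Γ
    rw [zero_def, mk_add_mk γ]
    refine mk_eq_mk γ ?_
    let _ := auxCommSemiring (T := T) γ
    let _ := auxModule (T := T) M γ
    simp only [act_eq_smul _ γ, tri_eq_mul _ γ, den]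
    match_scalars
    ring
  add_comm x y := by
    induction x using Loc.ind with | _ m s
    induction y using Loc.ind with | _ n t
    let γ : Γ := Classical.arbitrary Γ
    rw [mk_add_mk γ, mk_add_mk γ]
    refine mk_eq_mk γ ?_
    let _ := auxCommSemiring (T := T) γ
    let _ := auxModule (T := T) M γ
    simp only [act_eq_smul _ γ, tri_eq_mul _ γ, den]
    match_scalars <;> ring
  nsmul := nsmulRec

theorem locAct_add_left (γ : Γ) (x x' y : Loc S T) (z : Loc S M) :
    locAct γ (x + x') y z = locAct γ x y z + locAct γ x' y z := by
  induction x using Loc.ind with | _ a s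
  induction x' using Loc.ind with | _ a' s'
  induction y using Loc.ind with | _ b t
  induction z using Loc.ind with | _ m r
  simp only [mk_add_mk γ, locAct_mk]
  refine mk_eq_mk γ ?_
  let _ := auxCommSemiring (T := T) γ
  let _ := auxModule (T := T) M γ
  simp only [act_self]
  simp only [act_eq_smul _ γ, tri_eq_mul _ γ, den]
  match_scalars <;> ring

theorem locAct_add_mid (γ : Γ) (x y y' : Loc S T) (z : Loc S M) :
    locAct γ x (y + y') z = locAct γ x y z + locAct γ x y' z := by
  induction x using Loc.ind with | _ a s
  induction y using Loc.ind with | _ b t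
  induction y' using Loc.ind with | _ b' t'
  induction z using Loc.ind with | _ m r
  simp only [mk_add_mk γ, locAct_mk]
  refine mk_eq_mk γ ?_
  let _ := auxCommSemiring (T := T) γ
  let _ := auxModule (T := T) M γ
  simp only [act_self]
  simp only [act_eq_smul _ γ, tri_eq_mul _ γ, den]
  match_scalars <;> ring

theorem locAct_add_right (γ : Γ) (x y : Loc S T) (z z' : Loc S M) :
    locAct γ x y (z + z') = locAct γ x y z + locAct γ x y z' := by
  induction x using Loc.ind with | _ a s
  induction y using Loc.ind with | _ b t
  induction z using Loc.ind with | _ m r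
  induction z' using Loc.ind with | _ m' r'
  simp only [mk_add_mk γ, locAct_mk]
  refine mk_eq_mk γ ?_
  let _ := auxCommSemiring (T := T) γ
  let _ := auxModule (T := T) M γ
  simp only [act_eq_smul _ γ, tri_eq_mul _ γ, den]
  match_scalars <;> ring

theorem locAct_assoc (γ δ : Γ) (x y x' y' : Loc S T) (z : Loc S M) :
    locAct δ x y (locAct γ x' y' z) = locAct δ (locAct γ x y x') y' z := by
  induction x using Loc.ind with | _ a s
  induction y using Loc.ind with | _ b t
  induction x' using Loc.ind with | _ a' s'
  induction y' using Loc.ind with | _ b' t'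
  induction z using Loc.ind with | _ m r
  simp only [locAct_mk]
  refine mk_eq_mk γ ?_
  let _ := auxCommSemiring (T := T) γ
  let _ := auxModule (T := T) M γ
  simp only [act_self]
  simp only [act_eq_smul _ γ, tri_eq_mul _ γ, den]
  match_scalars <;> ring

theorem locAct_zero_left (γ : Γ) (y : Loc S T) (z : Loc S M) :
    locAct γ 0 y z = 0 := by
  induction y using Loc.ind with | _ b t
  induction z using Loc.ind with | _ m r
  simp only [zero_def, locAct_mk]
  refine mk_eq_mk γ ?_
  let _ := auxCommSemiring (T := T) γ
  let _ := auxModule (T := T) M γ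
  simp only [act_eq_smul _ γ, tri_eq_mul _ γ, den]
  match_scalars
  ring

theorem locAct_zero_mid (γ : Γ) (x : Loc S T) (z : Loc S M) :
    locAct γ x 0 z = 0 := by
  induction x using Loc.ind with | _ a s
  induction z using Loc.ind with | _ m r
  simp only [zero_def, locAct_mk]
  refine mk_eq_mk γ ?_
  let _ := auxCommSemiring (T := T) γ
  let _ := auxModule (T := T) M γ
  simp only [act_eq_smul _ γ, tri_eq_mul _ γ, den]
  match_scalars
  ring

theorem locAct_zero_right (γ : Γ) (x y : Loc S T) :
    locAct γ x y (0 : Loc S M) = 0 := by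
  induction x using Loc.ind with | _ a s
  induction y using Loc.ind with | _ b t
  simp only [zero_def, locAct_mk]
  refine mk_eq_mk γ ?_
  let _ := auxCommSemiring (T := T) γ
  let _ := auxModule (T := T) M γ
  simp only [act_eq_smul _ γ, tri_eq_mul _ γ, den]
  match_scalars

instance : One (Loc S T) where
  one := mk 1 ⟨1, S.one_mem⟩

theorem one_def : (1 : Loc S T) = mk 1 ⟨1, S.one_mem⟩ := rfl

theorem locAct_one_one (γ : Γ) (z : Loc S M) :
    locAct γ 1 1 z = z := by
  induction z using Loc.ind with | _ m r
  simp only [one_def, locAct_mk]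
  refine mk_eq_mk γ ?_
  let _ := auxCommSemiring (T := T) γ
  let _ := auxModule (T := T) M γ
  simp only [act_eq_smul _ γ, tri_eq_mul _ γ, den]
  match_scalars
  ring

theorem locAct_comm (γ : Γ) (x y z : Loc S T) : locAct γ x y z = locAct γ y x z := by
  induction x using Loc.ind with | _ a s
  induction y using Loc.ind with | _ b t
  induction z using Loc.ind with | _ c r
  simp only [locAct_mk]
  refine mk_eq_mk γ ?_
  let _ := auxCommSemiring (T := T) γ
  change tri γ _ 1 _ = tri γ _ 1 _
  simp only [act_self, tri_eq_mul _ γ, den]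
  ring

theorem one_locAct_one (γ : Γ) (x : Loc S T) : locAct γ 1 x 1 = x := by
  induction x using Loc.ind with | _ a s
  simp only [one_def, locAct_mk]
  refine mk_eq_mk γ ?_
  let _ := auxCommSemiring (T := T) γ
  change tri γ _ 1 _ = tri γ _ 1 _
  simp only [act_self, tri_eq_mul _ γ, den]
  ring

theorem one_one_locAct (γ : Γ) (x : Loc S T) : locAct γ x 1 1 = x := by
  induction x using Loc.ind with | _ a s
  simp only [one_def, locAct_mk]
  refine mk_eq_mk γ ?_
  let _ := auxCommSemiring (T := T) γ
  change tri γ _ 1 _ = tri γ _ 1 _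
  simp only [act_self, tri_eq_mul _ γ, den]
  ring

/-- `S⁻¹T` is a commutative ternary `Γ`-semiring. -/
instance : CommTernaryGammaSemiring Γ (Loc S T) where
  tri := locAct
  tri_add_left γ x x' y z := locAct_add_left γ x x' y z
  tri_add_mid := locAct_add_mid
  tri_add_right := locAct_add_right
  tri_assoc := locAct_assoc
  tri_zero_mid := locAct_zero_mid
  tri_comm := locAct_comm
  tri_one_one := locAct_one_one
  one_tri_one := one_locAct_one
  one_one_tri := one_one_locAct

/-- `S⁻¹M` is a `Γ`-module over `S⁻¹T`. -/
instance : GammaModule Γ (Loc S T) (Loc S M) where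
  act := locAct
  act_add_left γ x x' y z := locAct_add_left γ x x' y z
  act_add_mid := locAct_add_mid
  act_add_right := locAct_add_right
  act_assoc := locAct_assoc
  act_zero_left := locAct_zero_left
  act_zero_mid := locAct_zero_mid
  act_zero_right := locAct_zero_right
  act_one_one := locAct_one_one

theorem tri_mk (γ : Γ) (a b c : T) (s t u : S.carrier) :
    tri γ (mk a s : Loc S T) (mk b t) (mk c u) = mk (tri γ a b c) (den γ s t u) :=
  rfl

theorem act_mk (γ : Γ) (a b : T) (m : M) (s t u : S.carrier) :
    act γ (mk a s : Loc S T) (mk b t) (mk m u : Loc S M) = mk (act γ a b m) (den γ s t u) :=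
  rfl

/-- The canonical map `S⁻¹M → S'⁻¹M`, `m / s ↦ m / s`, for `S ⊆ S'`. -/
def map {S' : MulSystem Γ T} (h : S.carrier ⊆ S'.carrier) : Loc S M → Loc S' M :=
  Quotient.map (sa := locSetoid S M) (sb := locSetoid S' M) (fun p => (p.1, ⟨p.2, h p.2.2⟩))
    fun _ _ ⟨u, hu, hpq⟩ => ⟨u, h hu, hpq⟩

theorem map_mk {S' : MulSystem Γ T} (h : S.carrier ⊆ S'.carrier) (m : M) (s : S.carrier) :
    map h (mk m s : Loc S M) = mk m ⟨(s : T), h s.2⟩ :=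
  rfl

end Loc

end Localization

/-! ### Homomorphisms and the category of `Γ`-modules -/

/-- A `Γ`-homomorphism of `Γ`-modules over `T`. -/
@[ext]
structure GammaModuleHom (Γ : Type w) (T : Type u) (M : Type v) (N : Type v) [AddCommMonoid T]
    [One T] [CommTernaryGammaSemiring Γ T] [AddCommMonoid M] [GammaModule Γ T M] [AddCommMonoid N]
    [GammaModule Γ T N] where
  toFun : M → N
  map_zero : toFun 0 = 0
  map_add : ∀ m m', toFun (m + m') = toFun m + toFun m'
  map_act : ∀ (γ : Γ) (a b : T) m, toFun (act γ a b m) = act γ a b (toFun m)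

namespace GammaModuleHom

variable {Γ : Type w} {T : Type u} [AddCommMonoid T] [One T] [CommTernaryGammaSemiring Γ T]
  {M N K : Type v} [AddCommMonoid M] [GammaModule Γ T M] [AddCommMonoid N] [GammaModule Γ T N]
  [AddCommMonoid K] [GammaModule Γ T K]

variable (Γ T M) in
/-- The identity. -/
def id : GammaModuleHom Γ T M M where
  toFun m := m
  map_zero := rfl
  map_add _ _ := rfl
  map_act _ _ _ _ := rfl

/-- Composition (first `f`, then `g`). -/
def comp (f : GammaModuleHom Γ T M N) (g : GammaModuleHom Γ T N K) : GammaModuleHom Γ T M K where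
  toFun m := g.toFun (f.toFun m)
  map_zero := by rw [f.map_zero, g.map_zero]
  map_add m m' := by rw [f.map_add, g.map_add]
  map_act γ a b m := by rw [f.map_act, g.map_act]

end GammaModuleHom

/-- The type of objects of the category `Mod_T` of `Γ`-modules over `T`. -/
structure GammaModuleCat (Γ : Type w) (T : Type u) [AddCommMonoid T] [One T]
    [CommTernaryGammaSemiring Γ T] where
  carrier : Type u
  [addCommMonoid : AddCommMonoid carrier]
  [gammaModule : GammaModule Γ T carrier]

attribute [instance] GammaModuleCat.addCommMonoid GammaModuleCat.gammaModule

instance (Γ : Type w) (T : Type u) [AddCommMonoid T] [One T] [CommTernaryGammaSemiring Γ T] :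
    Category.{u} (GammaModuleCat Γ T) where
  Hom M N := GammaModuleHom Γ T M.carrier N.carrier
  id M := GammaModuleHom.id Γ T M.carrier
  comp f g := f.comp g

/-! ### The structure sheaf and sheaves of `Γ`-modules -/

section Sheaves

variable (Γ : Type w) [Nonempty Γ] (T : Type u) [AddCommMonoid T] [One T]
  [CommTernaryGammaSemiring Γ T]

/-- The topological space `Spec_Γ(T)`. -/
abbrev specTop : TopCat.{u} := TopCat.of (Spec Γ T)

/-- The condition `s(Q) = a / b` in `T_Q`, with fixed `a, b ∈ T`, `b ∉ Q`, for all `Q` in an open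
set. -/
def fractionPrelocal :
    TopCat.PrelocalPredicate (fun P : specTop Γ T => Loc (Spec.primeCompl P) T) where
  pred {U} s := ∃ a b : T, ∀ Q : U, ∃ h : b ∉ Q.1.carrier, s Q = Loc.mk (S := Spec.primeCompl Q.1) a ⟨b, h⟩
  res := by
    rintro U V i s ⟨a, b, h⟩
    exact ⟨a, b, fun Q => h ⟨Q.1, i.le Q.2⟩⟩

/-- The structure sheaf: its sections over `U` are the functions `s` on `U` with `s(P) ∈ T_P` that
are locally of the form `Q ↦ a / b`. -/
def structureSheaf : TopCat.Sheaf (Type u) (specTop Γ T) :=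
  TopCat.subsheafToTypes (fractionPrelocal Γ T).sheafify

/-- The sections `𝒪(U)` of the structure sheaf. -/
abbrev OSections (U : Opens (specTop Γ T)) : Type u := (structureSheaf Γ T).obj.obj (op U)

/-- The condition that, for all `Q` in an open set, `s(Q)` is the image in `M_Q` of a fixed
`x ∈ M_a`, where `a ∉ Q`. -/
def modulePrelocal (M : Type u) [AddCommMonoid M] [GammaModule Γ T M] :
    TopCat.PrelocalPredicate (fun P : specTop Γ T => Loc (Spec.primeCompl P) M) where
  pred {U} s := ∃ (a : T) (x : Loc (powers Γ a) M), ∀ Q : U, ∃ h : a ∉ Q.1.carrier,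
    s Q = Loc.map (powers_subset (S := Spec.primeCompl Q.1) h) x
  res := by
    rintro U V i s ⟨a, x, h⟩
    exact ⟨a, x, fun Q => h ⟨Q.1, i.le Q.2⟩⟩

/-- The sheaf of sets underlying `M̃`: the sheafification of `D(a) ↦ M_a`, realized as the sheaf of
functions `s` with `s(P) ∈ M_P` that are locally given by an element of some `M_a`. -/
def tildeSheaf (M : Type u) [AddCommMonoid M] [GammaModule Γ T M] :
    TopCat.Sheaf (Type u) (specTop Γ T) :=
  TopCat.subsheafToTypes (modulePrelocal Γ T M).sheafify

/-- The sections of `M̃` over `U`. -/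
abbrev TildeSections (M : Type u) [AddCommMonoid M] [GammaModule Γ T M] (U : Opens (specTop Γ T)) :
    Type u :=
  (tildeSheaf Γ T M).obj.obj (op U)

variable {Γ T}

theorem modulePrelocal_iff {M : Type u} [AddCommMonoid M] [GammaModule Γ T M]
    {U : Opens (specTop Γ T)} {s : ∀ P : U, Loc (Spec.primeCompl P.1) M} :
    (modulePrelocal Γ T M).pred s ↔
      ∃ (m : M) (b : T), ∀ Q : U, ∃ h : b ∉ Q.1.carrier, s Q = Loc.mk (S := Spec.primeCompl Q.1) m ⟨b, h⟩ := by
  constructor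
  · rintro ⟨a, x, h⟩
    induction x using Loc.ind with | _ m b
    exact ⟨m, b, fun Q => ⟨powers_subset (S := Spec.primeCompl Q.1) (h Q).1 b.2, (h Q).2⟩⟩
  · rintro ⟨m, b, h⟩
    exact ⟨b, Loc.mk m ⟨b, .self⟩, h⟩

/-- `s` is locally a fraction. -/
def IsLocFrac {M : Type u} [AddCommMonoid M] [GammaModule Γ T M] {U : Opens (specTop Γ T)}
    (s : ∀ P : U, Loc (Spec.primeCompl P.1) M) : Prop :=
  ∀ P : U, ∃ V : Opens (specTop Γ T), P.1 ∈ V ∧ ∃ (i : V ≤ U) (m : M) (b : T),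
    ∀ Q : V, ∃ h : b ∉ Q.1.carrier, s ⟨Q.1, i Q.2⟩ = Loc.mk (S := Spec.primeCompl Q.1) m ⟨b, h⟩

theorem fraction_pred_iff {U : Opens (specTop Γ T)}
    {s : ∀ P : U, Loc (Spec.primeCompl P.1) T} :
    (fractionPrelocal Γ T).sheafify.pred s ↔ IsLocFrac s := by
  constructor
  · intro h P
    obtain ⟨V, hV, i, a, b, h⟩ := h P
    exact ⟨V, hV, i.le, a, b, h⟩
  · intro h P
    obtain ⟨V, hV, i, a, b, h⟩ := h P
    exact ⟨V, hV, homOfLE i, a, b, h⟩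

section Closure

variable {M : Type u} [AddCommMonoid M] [GammaModule Γ T M] {U : Opens (specTop Γ T)}

theorem module_pred_iff {s : ∀ P : U, Loc (Spec.primeCompl P.1) M} :
    (modulePrelocal Γ T M).sheafify.pred s ↔ IsLocFrac s := by
  constructor
  · intro h P
    obtain ⟨V, hV, i, h⟩ := h P
    obtain ⟨m, b, h⟩ := modulePrelocal_iff.1 h
    exact ⟨V, hV, i.le, m, b, h⟩
  · intro h P
    obtain ⟨V, hV, i, m, b, h⟩ := h P
    exact ⟨V, hV, homOfLE i, modulePrelocal_iff.2 ⟨m, b, h⟩⟩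

theorem IsLocFrac.zero : IsLocFrac (M := M) (U := U) fun _ => 0 :=
  fun P => ⟨U, P.2, le_rfl, 0, 1, fun Q => ⟨Spec.one_notMem Q.1, rfl⟩⟩

theorem IsLocFrac.one : IsLocFrac (M := T) (U := U) fun _ => 1 :=
  fun P => ⟨U, P.2, le_rfl, 1, 1, fun Q => ⟨Spec.one_notMem Q.1, rfl⟩⟩

theorem IsLocFrac.add {s t : ∀ P : U, Loc (Spec.primeCompl P.1) M} (hs : IsLocFrac s)
    (ht : IsLocFrac t) : IsLocFrac fun P => s P + t P := by
  intro P
  obtain ⟨V, hV, i, m, b, h⟩ := hs P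
  obtain ⟨W, hW, j, n, c, k⟩ := ht P
  let γ : Γ := Classical.arbitrary Γ
  refine ⟨V ⊓ W, ⟨hV, hW⟩, inf_le_left.trans i, act γ c c m + act γ b c n, tri γ b c c,
    fun Q => ?_⟩
  obtain ⟨hb, h⟩ := h ⟨Q.1, Q.2.1⟩
  obtain ⟨hc, k⟩ := k ⟨Q.1, Q.2.2⟩
  exact ⟨(Spec.primeCompl Q.1).tri_mem γ b c c hb hc hc,
    (congrArg₂ (· + ·) h k).trans (Loc.mk_add_mk γ _ _ _ _)⟩

theorem IsLocFrac.act (γ : Γ) {s t : ∀ P : U, Loc (Spec.primeCompl P.1) T}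
    {x : ∀ P : U, Loc (Spec.primeCompl P.1) M} (hs : IsLocFrac s) (ht : IsLocFrac t)
    (hx : IsLocFrac x) : IsLocFrac fun P => act γ (s P) (t P) (x P) := by
  intro P
  obtain ⟨V, hV, i, a, b, h⟩ := hs P
  obtain ⟨W, hW, j, a', c, k⟩ := ht P
  obtain ⟨W', hW', j', m, d, l⟩ := hx P
  refine ⟨V ⊓ W ⊓ W', ⟨⟨hV, hW⟩, hW'⟩, (inf_le_left.trans inf_le_left).trans i,
    GammaModule.act γ a a' m, tri γ b c d, fun Q => ?_⟩
  obtain ⟨hb, h⟩ := h ⟨Q.1, Q.2.1.1⟩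
  obtain ⟨hc, k⟩ := k ⟨Q.1, Q.2.1.2⟩
  obtain ⟨hd, l⟩ := l ⟨Q.1, Q.2.2⟩
  refine ⟨(Spec.primeCompl Q.1).tri_mem γ b c d hb hc hd, ?_⟩
  beta_reduce
  rw [h, k, l]
  rfl

end Closure

section Instances

variable {U : Opens (specTop Γ T)}

theorem OSections.ext {s t : OSections Γ T U} (h : ∀ P, s.1 P = t.1 P) : s = t :=
  Subtype.ext (funext h)

instance : Zero (OSections Γ T U) where
  zero := ⟨fun _ => 0, fraction_pred_iff.2 .zero⟩

instance : One (OSections Γ T U) where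
  one := ⟨fun _ => 1, fraction_pred_iff.2 .one⟩

instance : Add (OSections Γ T U) where
  add s t := ⟨fun P => s.1 P + t.1 P,
    fraction_pred_iff.2 ((fraction_pred_iff.1 s.2).add (fraction_pred_iff.1 t.2))⟩

/-- The sections of the structure sheaf are added pointwise. -/
instance : AddCommMonoid (OSections Γ T U) where
  add_assoc _ _ _ := OSections.ext fun _ => add_assoc _ _ _
  zero_add _ := OSections.ext fun _ => zero_add _
  add_zero _ := OSections.ext fun _ => add_zero _
  add_comm _ _ := OSections.ext fun _ => add_comm _ _
  nsmul := nsmulRec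

/-- `𝒪(U)` is a commutative ternary `Γ`-semiring under the pointwise operations. -/
instance : CommTernaryGammaSemiring Γ (OSections Γ T U) where
  tri γ r s t := ⟨fun P => tri γ (r.1 P) (s.1 P) (t.1 P),
    fraction_pred_iff.2 (IsLocFrac.act γ (fraction_pred_iff.1 r.2) (fraction_pred_iff.1 s.2)
      (fraction_pred_iff.1 t.2))⟩
  tri_add_left _ _ _ _ _ := OSections.ext fun _ => tri_add_left _ _ _ _ _
  tri_add_mid _ _ _ _ _ := OSections.ext fun _ => tri_add_mid _ _ _ _ _
  tri_add_right _ _ _ _ _ := OSections.ext fun _ => tri_add_right _ _ _ _ _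
  tri_assoc _ _ _ _ _ _ _ := OSections.ext fun _ => tri_assoc _ _ _ _ _ _ _
  tri_zero_mid _ _ _ := OSections.ext fun _ => tri_zero_mid _ _ _
  tri_comm _ _ _ _ := OSections.ext fun _ => tri_comm _ _ _ _
  tri_one_one _ _ := OSections.ext fun _ => tri_one_one _ _
  one_tri_one _ _ := OSections.ext fun _ => one_tri_one _ _
  one_one_tri _ _ := OSections.ext fun _ => one_one_tri _ _

variable {M : Type u} [AddCommMonoid M] [GammaModule Γ T M]

theorem TildeSections.ext {s t : TildeSections Γ T M U} (h : ∀ P, s.1 P = t.1 P) : s = t :=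
  Subtype.ext (funext h)

instance : Zero (TildeSections Γ T M U) where
  zero := ⟨fun _ => 0, module_pred_iff.2 .zero⟩

instance : Add (TildeSections Γ T M U) where
  add s t := ⟨fun P => s.1 P + t.1 P,
    module_pred_iff.2 ((module_pred_iff.1 s.2).add (module_pred_iff.1 t.2))⟩

/-- The sections of `M̃` are added pointwise. -/
instance : AddCommMonoid (TildeSections Γ T M U) where
  add_assoc _ _ _ := TildeSections.ext fun _ => add_assoc _ _ _
  zero_add _ := TildeSections.ext fun _ => zero_add _
  add_zero _ := TildeSections.ext fun _ => add_zero _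
  add_comm _ _ := TildeSections.ext fun _ => add_comm _ _
  nsmul := nsmulRec

/-- `𝒪(U)` acts pointwise on the sections of `M̃` over `U`. -/
instance : GammaModule Γ (OSections Γ T U) (TildeSections Γ T M U) where
  act γ r s x := ⟨fun P => act γ (r.1 P) (s.1 P) (x.1 P),
    module_pred_iff.2 (IsLocFrac.act γ (fraction_pred_iff.1 r.2) (fraction_pred_iff.1 s.2)
      (module_pred_iff.1 x.2))⟩
  act_add_left _ _ _ _ _ := TildeSections.ext fun _ => act_add_left _ _ _ _ _
  act_add_mid _ _ _ _ _ := TildeSections.ext fun _ => act_add_mid _ _ _ _ _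
  act_add_right _ _ _ _ _ := TildeSections.ext fun _ => act_add_right _ _ _ _ _
  act_assoc _ _ _ _ _ _ _ := TildeSections.ext fun _ => act_assoc _ _ _ _ _ _ _
  act_zero_left _ _ _ := TildeSections.ext fun _ => act_zero_left _ _ _
  act_zero_mid _ _ _ := TildeSections.ext fun _ => act_zero_mid _ _ _
  act_zero_right _ _ _ := TildeSections.ext fun _ => act_zero_right _ _ _
  act_one_one _ _ := TildeSections.ext fun _ => act_one_one _ _

end Instances

variable (Γ T)

/-- A sheaf of `Γ`-modules on `Spec_Γ(T)`: a sheaf of sets, with a `Γ`-module structure over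
`𝒪(U)` on the sections over each open `U`, that is compatible with the restriction maps. -/
structure ModuleSheaf where
  sheaf : TopCat.Sheaf (Type u) (specTop Γ T)
  [addCommMonoid : ∀ U : Opens (specTop Γ T), AddCommMonoid (sheaf.obj.obj (op U))]
  [gammaModule : ∀ U : Opens (specTop Γ T),
    GammaModule Γ (OSections Γ T U) (sheaf.obj.obj (op U))]
  res_zero : ∀ {U V : Opens (specTop Γ T)} (i : V ⟶ U), sheaf.obj.map i.op 0 = 0
  res_add : ∀ {U V : Opens (specTop Γ T)} (i : V ⟶ U) (x y : sheaf.obj.obj (op U)),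
    sheaf.obj.map i.op (x + y) = sheaf.obj.map i.op x + sheaf.obj.map i.op y
  res_act : ∀ {U V : Opens (specTop Γ T)} (i : V ⟶ U) (γ : Γ) (r s : OSections Γ T U)
    (x : sheaf.obj.obj (op U)),
    sheaf.obj.map i.op (act γ r s x) =
      act γ ((structureSheaf Γ T).obj.map i.op r) ((structureSheaf Γ T).obj.map i.op s)
        (sheaf.obj.map i.op x)

variable {Γ T}

namespace ModuleSheaf

attribute [instance] ModuleSheaf.addCommMonoid ModuleSheaf.gammaModule

/-- The sections of `F` over `U`. -/
abbrev Sections (F : ModuleSheaf Γ T) (U : Opens (specTop Γ T)) : Type u :=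
  F.sheaf.obj.obj (op U)

/-- The restriction `F(U) → F(V)`. -/
abbrev res (F : ModuleSheaf Γ T) {U V : Opens (specTop Γ T)} (i : V ⟶ U) :
    F.Sections U → F.Sections V :=
  fun x => F.sheaf.obj.map i.op x

/-- A morphism of sheaves of `Γ`-modules: `𝒪(U)`-linear maps `F(U) → G(U)` compatible with
restrictions. -/
@[ext]
structure Hom (F G : ModuleSheaf Γ T) where
  app : ∀ U : Opens (specTop Γ T),
    GammaModuleHom Γ (OSections Γ T U) (F.Sections U) (G.Sections U)
  naturality : ∀ {U V : Opens (specTop Γ T)} (i : V ⟶ U) (x : F.Sections U),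
    (app V).toFun (F.res i x) = G.res i ((app U).toFun x)

instance : Category.{u} (ModuleSheaf Γ T) where
  Hom F G := Hom F G
  id F := ⟨fun _ => GammaModuleHom.id _ _ _, fun _ _ => rfl⟩
  comp f g := ⟨fun U => (f.app U).comp (g.app U), fun i x => by
    change (g.app _).toFun ((f.app _).toFun _) = _
    rw [f.naturality, g.naturality]
    rfl⟩

/-- `F` and `G` are isomorphic over the open set `U`: there are compatible `𝒪(V)`-linear bijections
`F(V) → G(V)` for all open `V ⊆ U`. -/
def IsoOver (U : Opens (specTop Γ T)) (F G : ModuleSheaf Γ T) : Prop :=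
  ∃ e : ∀ V : Opens (specTop Γ T), V ≤ U →
      GammaModuleHom Γ (OSections Γ T V) (F.Sections V) (G.Sections V),
    (∀ V hV, Function.Bijective (e V hV).toFun) ∧
    ∀ {V W : Opens (specTop Γ T)} (hV : V ≤ U) (hW : W ≤ U) (i : W ⟶ V) (x : F.Sections V),
      (e W hW).toFun (F.res i x) = G.res i ((e V hV).toFun x)

end ModuleSheaf

/-- The sheaf `M̃` of `Γ`-modules on `Spec_Γ(T)`. -/
def tilde (M : GammaModuleCat Γ T) : ModuleSheaf Γ T where
  sheaf := tildeSheaf Γ T M.carrier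
  addCommMonoid U := inferInstanceAs (AddCommMonoid (TildeSections Γ T M.carrier U))
  gammaModule U :=
    inferInstanceAs (GammaModule Γ (OSections Γ T U) (TildeSections Γ T M.carrier U))
  res_zero _ := rfl
  res_add _ _ _ := rfl
  res_act _ _ _ _ _ := rfl

variable (Γ T) in
/-- A sheaf of `Γ`-modules on `Spec_Γ(T)` is quasi-coherent if, locally on `Spec_Γ(T)`, it is
isomorphic to the sheaf `M̃` associated with a `Γ`-module `M`. -/
def IsQuasiCoherent : ObjectProperty (ModuleSheaf Γ T) := fun F =>
  ∀ P : specTop Γ T, ∃ U : Opens (specTop Γ T), P ∈ U ∧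
    ∃ M : GammaModuleCat Γ T, ModuleSheaf.IsoOver U F (tilde M)

variable (Γ T) in
/-- The category `QCoh(Spec_Γ(T))`. -/
abbrev QCoh := (IsQuasiCoherent Γ T).FullSubcategory

theorem tilde_isQuasiCoherent (M : GammaModuleCat Γ T) : IsQuasiCoherent Γ T (tilde M) :=
  fun _ => ⟨⊤, trivial, M, fun _ _ => GammaModuleHom.id _ _ _, fun _ _ => Function.bijective_id,
    fun _ _ _ _ => rfl⟩

/-- The map `S⁻¹M → S⁻¹N`, `m / s ↦ f(m) / s`. -/
def Loc.mapHom {S : MulSystem Γ T} {M N : Type u} [AddCommMonoid M] [GammaModule Γ T M]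
    [AddCommMonoid N] [GammaModule Γ T N] (f : GammaModuleHom Γ T M N) : Loc S M → Loc S N :=
  Quotient.map (sa := locSetoid S M) (sb := locSetoid S N) (fun p => (f.toFun p.1, p.2))
    fun p q ⟨u, hu, h⟩ => ⟨u, hu, fun γ => by rw [← f.map_act, ← f.map_act, h]⟩

namespace Loc

variable {S : MulSystem Γ T} {M N K : Type u} [AddCommMonoid M] [GammaModule Γ T M]
  [AddCommMonoid N] [GammaModule Γ T N] [AddCommMonoid K] [GammaModule Γ T K]

theorem mapHom_mk (f : GammaModuleHom Γ T M N) (m : M) (s : S.carrier) :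
    mapHom f (mk m s : Loc S M) = mk (f.toFun m) s :=
  rfl

theorem mapHom_zero (f : GammaModuleHom Γ T M N) : mapHom f (0 : Loc S M) = 0 := by
  rw [zero_def, mapHom_mk, f.map_zero]
  rfl

theorem mapHom_add (f : GammaModuleHom Γ T M N) (x y : Loc S M) :
    mapHom f (x + y) = mapHom f x + mapHom f y := by
  induction x using Loc.ind with | _ m s
  induction y using Loc.ind with | _ n t
  have γ : Γ := Classical.arbitrary Γ
  rw [mk_add_mk γ, mapHom_mk, mapHom_mk, mapHom_mk, mk_add_mk γ, f.map_add, f.map_act, f.map_act]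

theorem mapHom_act (f : GammaModuleHom Γ T M N) (γ : Γ) (x y : Loc S T) (z : Loc S M) :
    mapHom f (act γ x y z) = act γ x y (mapHom f z) := by
  induction x using Loc.ind with | _ a s
  induction y using Loc.ind with | _ b t
  induction z using Loc.ind with | _ m r
  rw [act_mk, mapHom_mk, mapHom_mk, act_mk, f.map_act]

theorem mapHom_id (x : Loc S M) : mapHom (GammaModuleHom.id Γ T M) x = x := by
  induction x using Loc.ind with | _ m s
  rfl

theorem mapHom_comp (f : GammaModuleHom Γ T M N) (g : GammaModuleHom Γ T N K) (x : Loc S M) :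
    mapHom (f.comp g) x = mapHom g (mapHom f x) := by
  induction x using Loc.ind with | _ m s
  rfl

end Loc

theorem IsLocFrac.mapHom {M N : Type u} [AddCommMonoid M] [GammaModule Γ T M] [AddCommMonoid N]
    [GammaModule Γ T N] (f : GammaModuleHom Γ T M N) {U : Opens (specTop Γ T)}
    {s : ∀ P : U, Loc (Spec.primeCompl P.1) M} (hs : IsLocFrac s) :
    IsLocFrac fun P => Loc.mapHom f (s P) := by
  intro P
  obtain ⟨V, hV, i, m, b, h⟩ := hs P
  refine ⟨V, hV, i, f.toFun m, b, fun Q => ?_⟩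
  obtain ⟨hb, h⟩ := h Q
  exact ⟨hb, congrArg (Loc.mapHom f) h⟩

/-- The morphism `M̃ → Ñ` induced by `f : M → N`, which maps `s` to `P ↦ f_P(s(P))`. -/
def tildeMap {M N : GammaModuleCat Γ T} (f : M ⟶ N) : tilde M ⟶ tilde N where
  app U :=
    { toFun := fun s : TildeSections Γ T M.carrier U =>
        (⟨fun P => Loc.mapHom f (s.1 P),
          module_pred_iff.2 ((module_pred_iff.1 s.2).mapHom f)⟩ : TildeSections Γ T N.carrier U)
      map_zero := TildeSections.ext fun _ => Loc.mapHom_zero f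
      map_add := fun _ _ => TildeSections.ext fun _ => Loc.mapHom_add f _ _
      map_act := fun γ _ _ _ => TildeSections.ext fun _ => Loc.mapHom_act f γ _ _ _ }
  naturality _ _ := rfl

variable (Γ T) in
/-- The functor `M ↦ M̃` from `Mod_T` to the category of sheaves of `Γ`-modules. -/
def tildeFunctor : GammaModuleCat Γ T ⥤ ModuleSheaf Γ T where
  obj := tilde
  map := tildeMap
  map_id M := ModuleSheaf.Hom.ext (funext fun _ => GammaModuleHom.ext
    (funext fun _ => TildeSections.ext fun _ => Loc.mapHom_id _))
  map_comp f g := ModuleSheaf.Hom.ext (funext fun _ => GammaModuleHom.ext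
    (funext fun _ => TildeSections.ext fun _ => Loc.mapHom_comp f g _))

variable (Γ T) in
/-- The functor `Φ : Mod_T ⥤ QCoh(Spec_Γ(T))`, `M ↦ M̃`. -/
def tildeQCoh : GammaModuleCat Γ T ⥤ QCoh Γ T :=
  (IsQuasiCoherent Γ T).lift (tildeFunctor Γ T) tilde_isQuasiCoherent

end Sheaves

end GammaGeometry

end

noncomputable section

namespace GammaGeometry

open TernaryGammaSemiring CommTernaryGammaSemiring GammaModule

/-! ### The commutative semiring underlying a ternary `Γ`-semiring -/

/-! The identity element removes the ternary structure: `a * b = {a, b, 1}_γ` does not depend on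
`γ`, and `{a, b, c}_γ = a * b * c`, `{a, b, m}_γ = (a * b) • m` for every `γ`. So `T` is a
commutative semiring, `Γ`-modules are its modules, and prime ideals and fractions have their usual
meaning. What remains is the classical theorem on affine schemes, proved without subtraction: the
annihilator of `m - n` is replaced by the ideal of all `u` with `u • m = u • n`.

The finiteness comes from `Spec.exists_pow_mem_span`: if the `D(h)` cover `D(g)`, then a power of
`g` is a combination of the `h`, because the radical of an ideal is the intersection of the primes
above it. A partition of unity then shows that a section of `M̃` over `D(g)` is one fraction `m / g
^ n` (`exists_isFrac_pow`). For `g = 1` this makes `M → M̃(⊤)` bijective (`toTilde_bijective`), and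
full faithfulness follows, because sections of `M̃` are locally fractions of global ones.

For essential surjectivity let `M = F(⊤)`, with `F` quasi-coherent. Two facts pass from the sheaves
`M̃` to `F`: sections over `D(g)` that agree on `D(g) ∩ D(f)` become equal after multiplication by a
power of `f` (`eventually_pow_smul_eq`), and for `t` over `D(f)` some `f ^ n • t` extends to a
global section (`exists_extend`). Near each point, a section `x` of `F` therefore satisfies `b • x =
m` with `m` global and `b` invertible, and the fraction `m / b` is well defined in `M_P`. Sending
`x` to these fractions is a morphism `F → M̃`, bijective over every open set. -/

/-- The type `T`, equipped with the multiplication `a * b = {a, b, 1}_γ`. -/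
def Carr (_Γ : Type w) (T : Type u) : Type u := T

variable {Γ : Type w} [Nonempty Γ] {T : Type u} [AddCommMonoid T] [One T]
  [CommTernaryGammaSemiring Γ T]

instance : CommSemiring (Carr Γ T) := auxCommSemiring (T := T) (Classical.arbitrary Γ)

instance {M : Type v} [AddCommMonoid M] [GammaModule Γ T M] : Module (Carr Γ T) M :=
  auxModule (T := T) M (Classical.arbitrary Γ)

variable (Γ) in
/-- An element of `T`, as an element of the semiring `Carr Γ T`. -/
def toCarr (a : T) : Carr Γ T := a

/-- The product on `Carr Γ T` is built from one arbitrary parameter, but every parameter yields the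
same one. From here on `Γ` plays no role. -/
theorem toCarr_tri (γ : Γ) (a b c : T) :
    toCarr Γ (tri γ a b c) = toCarr Γ a * toCarr Γ b * toCarr Γ c :=
  tri_eq_mul γ (Classical.arbitrary Γ) a b c

theorem toCarr_one : toCarr Γ (1 : T) = 1 := rfl

theorem act_eq_toCarr_smul {M : Type v} [AddCommMonoid M] [GammaModule Γ T M] (γ : Γ) (a b : T)
    (m : M) : act γ a b m = (toCarr Γ a * toCarr Γ b) • m :=
  act_eq_smul γ (Classical.arbitrary Γ) a b m

/-- A `Carr Γ T`-linear map is a homomorphism of `Γ`-modules. -/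
def GammaModuleHom.ofLinearMap {M N : Type v} [AddCommMonoid M] [GammaModule Γ T M]
    [AddCommMonoid N] [GammaModule Γ T N] (f : M →ₗ[Carr Γ T] N) : GammaModuleHom Γ T M N where
  toFun := f
  map_zero := f.map_zero
  map_add := f.map_add
  map_act γ a b m := by rw [act_eq_toCarr_smul, act_eq_toCarr_smul, f.map_smul]

/-! ### Prime ideals and basic open sets -/

namespace Spec

theorem mul_mem_iff (P : Spec Γ T) (a b : Carr Γ T) :
    a * b ∈ P.carrier ↔ a ∈ P.carrier ∨ b ∈ P.carrier := by
  constructor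
  · intro h
    rcases P.prime (Classical.arbitrary Γ) a b (1 : T) h with h | h | h
    · exact .inl h
    · exact .inr h
    · exact absurd h P.one_notMem
  · rintro (h | h)
    · exact P.tri_mem_left (Classical.arbitrary Γ) a b (1 : T) h
    · exact P.tri_mem_mid (Classical.arbitrary Γ) b (1 : T) a h

theorem mul_notMem_iff (P : Spec Γ T) (a b : Carr Γ T) :
    a * b ∉ P.carrier ↔ a ∉ P.carrier ∧ b ∉ P.carrier := by
  rw [mul_mem_iff, not_or]

theorem one_notMem_carr (P : Spec Γ T) : (1 : Carr Γ T) ∉ P.carrier := P.one_notMem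

theorem pow_notMem (P : Spec Γ T) {a : Carr Γ T} (h : a ∉ P.carrier) (n : ℕ) :
    a ^ n ∉ P.carrier := by
  induction n with
  | zero => rw [pow_zero]; exact P.one_notMem_carr
  | succ n ih => rw [pow_succ, mul_notMem_iff]; exact ⟨ih, h⟩

/-- A prime `Γ`-ideal is in particular an ideal of the semiring, so if it contained `s` it would
contain the span. -/
theorem exists_notMem_of_span {P : Spec Γ T} {s : Set (Carr Γ T)} {a : Carr Γ T}
    (ha : a ∈ Ideal.span s) (h : a ∉ P.carrier) : ∃ b ∈ s, b ∉ P.carrier := by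
  by_contra! hc
  let J : Ideal (Carr Γ T) :=
    { carrier := P.carrier
      add_mem' := fun {a b} ha hb => P.add_mem a b ha hb
      zero_mem' := P.zero_mem
      smul_mem' := fun c x hx => (P.mul_mem_iff c x).2 (.inr hx) }
  exact h ((Ideal.span_le (I := J)).2 hc ha)

/-- The prime `Γ`-ideal given by a prime ideal of the underlying commutative semiring. -/
def ofIdeal (J : Ideal (Carr Γ T)) [hJ : J.IsPrime] : Spec Γ T where
  carrier := (J : Set (Carr Γ T))
  zero_mem := J.zero_mem
  add_mem _ _ ha hb := J.add_mem ha hb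
  tri_mem_left γ a b c ha := by
    change toCarr Γ _ ∈ J
    rw [toCarr_tri, mul_assoc]
    exact J.mul_mem_right _ ha
  tri_mem_mid γ a b c ha := by
    change toCarr Γ _ ∈ J
    rw [toCarr_tri, mul_right_comm]
    exact J.mul_mem_left _ ha
  tri_mem_right γ a b c ha := by
    change toCarr Γ _ ∈ J
    rw [toCarr_tri]
    exact J.mul_mem_left _ ha
  ne_univ h := hJ.ne_top (SetLike.coe_injective h)
  prime γ a b c h := by
    change toCarr Γ _ ∈ J at h
    rw [toCarr_tri] at h
    rcases hJ.mem_or_mem h with h | h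
    · rcases hJ.mem_or_mem h with h | h
      · exact .inl h
      · exact .inr (.inl h)
    · exact .inr (.inr h)

/-- If `D(g)` is covered by the `D(h)`, `h ∈ s`, then a power of `g` is in the ideal generated
by `s`. -/
theorem exists_pow_mem_span {s : Set (Carr Γ T)} {g : Carr Γ T}
    (H : ∀ P : Spec Γ T, g ∉ P.carrier → ∃ h ∈ s, h ∉ P.carrier) :
    ∃ n : ℕ, g ^ n ∈ Ideal.span s := by
  have : g ∈ (Ideal.span s).radical := by
    -- A prime containing `s` but not `g` would be a point of `D(g)` outside every `D(h)`.
    rw [Ideal.radical_eq_sInf, Ideal.mem_sInf]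
    rintro J ⟨hJ, hp⟩
    by_contra hg
    obtain ⟨h, hs, hh⟩ := H (ofIdeal J) hg
    exact hh (hJ (Ideal.subset_span hs))
  exact this

/-- If `D(g)` is covered by sets `D(h)`, finitely many of them suffice. -/
theorem exists_finset_cover {p : Carr Γ T → Prop} {g : Carr Γ T}
    (H : ∀ P : Spec Γ T, g ∉ P.carrier → ∃ h, p h ∧ h ∉ P.carrier) :
    ∃ s : Finset (Carr Γ T), (∀ h ∈ s, p h) ∧
      ∀ P : Spec Γ T, g ∉ P.carrier → ∃ h ∈ s, h ∉ P.carrier := by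
  obtain ⟨n, hn⟩ := exists_pow_mem_span (s := {h | p h}) (g := g) H
  -- A combination involves only finitely many generators, and these still cover `D(g)`: a prime
  -- that contains them all contains `g ^ n`, hence `g`.
  obtain ⟨s, hs, hn⟩ := Submodule.mem_span_finite_of_mem_span hn
  exact ⟨s, hs, fun P hP => exists_notMem_of_span hn (P.pow_notMem hP n)⟩

end Spec

/-- The open set `D(a)`. -/
def basicOpen (a : Carr Γ T) : Opens (specTop Γ T) where
  carrier := {P | a ∉ P.carrier}
  is_open' := by
    -- The complement is `V(I)` for `I` the principal ideal generated by `a`.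
    refine ⟨⟨(Ideal.span {a} : Set (Carr Γ T)), (Ideal.span {a} : Ideal (Carr Γ T)).zero_mem,
      fun _ _ => (Ideal.span {a} : Ideal (Carr Γ T)).add_mem, fun γ x b c hx => ?_,
      fun γ x b c hx => ?_, fun γ x b c hx => ?_⟩, ?_⟩
    · change toCarr Γ _ ∈ (Ideal.span {a} : Ideal (Carr Γ T))
      rw [toCarr_tri, mul_assoc]
      exact Ideal.mul_mem_right _ _ hx
    · change toCarr Γ _ ∈ (Ideal.span {a} : Ideal (Carr Γ T))
      rw [toCarr_tri, mul_right_comm]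
      exact Ideal.mul_mem_left _ _ hx
    · change toCarr Γ _ ∈ (Ideal.span {a} : Ideal (Carr Γ T))
      rw [toCarr_tri]
      exact Ideal.mul_mem_left _ _ hx
    · ext P
      constructor
      · intro h x hx
        by_contra hc
        obtain ⟨b, rfl, hb⟩ := Spec.exists_notMem_of_span hx hc
        exact h hb
      · intro h hc
        exact hc (h (Ideal.subset_span (α := Carr Γ T) rfl))

theorem basicOpen_mul (a b : Carr Γ T) : basicOpen (a * b) = basicOpen a ⊓ basicOpen b :=
  Opens.ext (Set.ext fun P => P.mul_notMem_iff a b)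

theorem basicOpen_one : basicOpen (1 : Carr Γ T) = ⊤ :=
  top_unique fun P _ => P.one_notMem_carr

/-- The complement of `U` is some `V(I)`. Any `a ∈ I` outside `P` will do, since a prime avoiding
`a` cannot contain `I`. -/
theorem exists_basicOpen_le {U : Opens (specTop Γ T)} {P : specTop Γ T} (hP : P ∈ U) :
    ∃ a : Carr Γ T, P ∈ basicOpen a ∧ basicOpen a ≤ U := by
  obtain ⟨I, hI⟩ : U.carrierᶜ ∈ {Z | ∃ I : GammaIdeal Γ T, Z = Spec.zeroLocus I} := U.is_open'
  have hn : P ∉ Spec.zeroLocus I := fun h => by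
    rw [← hI] at h
    exact h hP
  obtain ⟨a, ha, haP⟩ := Set.not_subset.1 hn
  refine ⟨a, haP, fun Q hQ => ?_⟩
  by_contra hc
  have : Q ∈ Spec.zeroLocus I := by
    rw [← hI]
    exact hc
  exact hQ (this ha)

/-! ### Fractions -/

section Fractions

variable {M : Type v} [AddCommMonoid M] [GammaModule Γ T M]

theorem Loc.mk_eq_iff {S : MulSystem Γ T} {m n : M} {s t : S.carrier} :
    (Loc.mk m s : Loc S M) = Loc.mk n t ↔
      ∃ u ∈ S.carrier, (toCarr Γ u * toCarr Γ (t : T)) • m = (toCarr Γ u * toCarr Γ (s : T)) • n := by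
  rw [Loc.mk_eq]
  simp only [act_eq_toCarr_smul]
  exact ⟨fun ⟨u, hu, h⟩ => ⟨u, hu, h (Classical.arbitrary Γ)⟩, fun ⟨u, hu, h⟩ => ⟨u, hu, fun _ => h⟩⟩

theorem Loc.mk_add_mk_same {S : MulSystem Γ T} (m n : M) (s : S.carrier) :
    (Loc.mk m s + Loc.mk n s : Loc S M) = Loc.mk (m + n) s := by
  rw [Loc.mk_add_mk (Classical.arbitrary Γ), Loc.mk_eq_iff]
  refine ⟨1, S.one_mem, ?_⟩
  simp only [act_eq_toCarr_smul, Loc.den, toCarr_tri, toCarr_one, one_mul, ← smul_add, smul_smul]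
  congr 1
  ring

/-- `z = m / b` in `M_P`. -/
def IsFrac {P : Spec Γ T} (z : Loc P.primeCompl M) (m : M) (b : Carr Γ T) : Prop :=
  ∃ h : b ∉ P.carrier, z = Loc.mk (S := P.primeCompl) m ⟨b, h⟩

namespace IsFrac

variable {P : Spec Γ T} {z z' : Loc P.primeCompl M} {m m' : M} {b b' : Carr Γ T}

theorem eq_iff (h : IsFrac z m b) (h' : IsFrac z' m' b') :
    z = z' ↔ ∃ u : Carr Γ T, u ∉ P.carrier ∧ (u * b') • m = (u * b) • m' := by
  obtain ⟨_, rfl⟩ := h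
  obtain ⟨_, rfl⟩ := h'
  exact Loc.mk_eq_iff

theorem scale (h : IsFrac z m b) {c : Carr Γ T} (hc : c ∉ P.carrier) :
    IsFrac z (c • m) (c * b) := by
  refine ⟨(P.mul_notMem_iff c b).2 ⟨hc, h.1⟩, ?_⟩
  refine (h.eq_iff ⟨_, rfl⟩).2 ⟨1, P.one_notMem_carr, ?_⟩
  rw [smul_smul]
  congr 1
  ring

theorem of_eq (h : IsFrac z m b) (hb' : b' ∉ P.carrier) {u : Carr Γ T} (hu : u ∉ P.carrier)
    (e : (u * b') • m = (u * b) • m') : IsFrac z m' b' :=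
  ⟨hb', (h.eq_iff ⟨hb', rfl⟩).2 ⟨u, hu, e⟩⟩

theorem exists_isFrac (z : Loc P.primeCompl M) : ∃ (m : M) (b : Carr Γ T), IsFrac z m b := by
  induction z using Loc.ind with | _ m s
  exact ⟨m, s.1, s.2, rfl⟩

theorem zero : IsFrac (0 : Loc P.primeCompl M) 0 1 := ⟨P.one_notMem_carr, rfl⟩

theorem add (h : IsFrac z m b) (h' : IsFrac z' m' b) : IsFrac (z + z') (m + m') b := by
  obtain ⟨hb, rfl⟩ := h
  obtain ⟨_, rfl⟩ := h'
  exact ⟨hb, Loc.mk_add_mk_same _ _ _⟩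

theorem act {x y : Loc P.primeCompl T} {a a' : T} {c c' : Carr Γ T} (γ : Γ) (hx : IsFrac x a c)
    (hy : IsFrac y a' c') (h : IsFrac z m b) :
    IsFrac (act γ x y z) ((toCarr Γ a * toCarr Γ a') • m) (c * c' * b) := by
  obtain ⟨hc, rfl⟩ := hx
  obtain ⟨hc', rfl⟩ := hy
  obtain ⟨hb, rfl⟩ := h
  have h1 : c * c' * b = tri (T := T) γ c c' b := (toCarr_tri (T := T) γ c c' b).symm
  rw [h1, ← act_eq_toCarr_smul γ]
  exact ⟨P.primeCompl.tri_mem γ c c' b hc hc' hb, rfl⟩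

theorem mapHom {M N : Type u} [AddCommMonoid M] [GammaModule Γ T M] [AddCommMonoid N]
    [GammaModule Γ T N] (f : GammaModuleHom Γ T M N) {z : Loc P.primeCompl M} {m : M}
    (h : IsFrac z m b) : IsFrac (Loc.mapHom f z) (f.toFun m) b := by
  obtain ⟨hb, rfl⟩ := h
  exact ⟨hb, rfl⟩

end IsFrac

end Fractions

/-! ### Sheaves of `Γ`-modules as sheaves of modules over `T` -/

/-- The section `a / b` of the structure sheaf. -/
def OSections.frac {U : Opens (specTop Γ T)} (a b : T) (h : U ≤ basicOpen (toCarr Γ b)) :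
    OSections Γ T U :=
  ⟨fun P => Loc.mk (S := Spec.primeCompl P.1) a ⟨b, h P.2⟩,
    fraction_pred_iff.2 fun P => ⟨U, P.2, le_rfl, a, b, fun Q => ⟨h Q.2, rfl⟩⟩⟩

/-- The section `a / 1` of the structure sheaf. -/
def OSections.const (U : Opens (specTop Γ T)) (a : T) : OSections Γ T U :=
  OSections.frac a 1 (le_top.trans basicOpen_one.ge)

theorem OSections.const_add (U : Opens (specTop Γ T)) (a b : T) :
    const U (a + b) = const U a + const U b :=
  OSections.ext fun P => (Loc.mk_add_mk_same (S := Spec.primeCompl P.1) a b _).symm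

theorem OSections.const_tri (U : Opens (specTop Γ T)) (γ : Γ) (a b c : T) :
    const U (tri γ a b c) = tri γ (const U a) (const U b) (const U c) := by
  refine OSections.ext fun P => ?_
  change _ = tri γ (Loc.mk (S := Spec.primeCompl P.1) a _) (Loc.mk b _) (Loc.mk c _)
  rw [Loc.tri_mk]
  have : ((1 : Carr Γ T) : T) = tri γ (1 : T) 1 1 := (tri_one_one γ (1 : T)).symm
  exact congrArg (Loc.mk (S := Spec.primeCompl P.1) _) (Subtype.ext this)

theorem OSections.const_mul (U : Opens (specTop Γ T)) (a b : Carr Γ T) :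
    toCarr Γ (const U (T := T) (a * b)) =
      toCarr Γ (const U (T := T) a) * toCarr Γ (const U (T := T) b) :=
  const_tri U (Classical.arbitrary Γ) a b 1

/-- If `r = a / c` then `c r = a`. -/
theorem OSections.const_mul_eq {U : Opens (specTop Γ T)} {r : OSections Γ T U} {a c : T}
    (h : ∀ Q : U, ∃ hc : c ∉ Q.1.carrier, r.1 Q = Loc.mk (S := Spec.primeCompl Q.1) a ⟨c, hc⟩) :
    toCarr Γ (const U c) * toCarr Γ r = toCarr Γ (const U a) := by
  refine OSections.ext fun P => ?_
  obtain ⟨hc, hr⟩ := h P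
  change tri (Classical.arbitrary Γ) (Loc.mk (S := Spec.primeCompl P.1) c _) (r.1 P) 1 =
    Loc.mk a _
  rw [hr, Loc.one_def, Loc.tri_mk]
  refine Loc.mk_eq.2 ⟨1, (Spec.primeCompl P.1).one_mem, fun γ => ?_⟩
  change tri γ 1 1 (tri _ c a 1) = tri γ 1 (tri _ 1 c 1) a
  rw [tri_one_one, one_tri_one, tri_comm γ, tri_one_mid, tri_eq γ (Classical.arbitrary Γ),
    one_one_tri]

theorem OSections.const_mul_frac {U : Opens (specTop Γ T)} (b : T)
    (h : U ≤ basicOpen (toCarr Γ b)) :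
    toCarr Γ (const U b) * toCarr Γ (frac 1 b h) = 1 :=
  const_mul_eq fun Q => ⟨h Q.2, rfl⟩

namespace ModuleSheaf

variable (F : ModuleSheaf Γ T)

/-- Restriction of scalars along `a ↦ a / 1`. It makes the sections over all open sets modules over
one fixed semiring, with linear restriction maps. -/
instance (U : Opens (specTop Γ T)) : GammaModule Γ T (F.Sections U) where
  act γ a b x := act γ (OSections.const U a) (OSections.const U b) x
  act_add_left _ _ _ _ _ := by rw [OSections.const_add, act_add_left]
  act_add_mid _ _ _ _ _ := by rw [OSections.const_add, act_add_mid]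
  act_add_right _ _ _ _ _ := act_add_right _ _ _ _ _
  act_assoc _ _ _ _ _ _ _ := by rw [OSections.const_tri, act_assoc]
  act_zero_left _ _ _ := act_zero_left _ _ _
  act_zero_mid _ _ _ := act_zero_mid _ _ _
  act_zero_right _ _ _ := act_zero_right _ _ _
  act_one_one _ _ := act_one_one _ _

variable {F}

theorem smul_eq_const_smul {U : Opens (specTop Γ T)} (a : Carr Γ T) (x : F.Sections U) :
    a • x = toCarr Γ (OSections.const U (a : T)) • x :=
  rfl

/-- The restriction `F(U) → F(V)`, as a linear map. -/
def resLin {U V : Opens (specTop Γ T)} (h : V ≤ U) :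
    F.Sections U →ₗ[Carr Γ T] F.Sections V where
  toFun := F.res (homOfLE h)
  map_add' := F.res_add _
  map_smul' _ x := F.res_act (homOfLE h) (Classical.arbitrary Γ) _ _ x

theorem resLin_act {U V : Opens (specTop Γ T)} (h : V ≤ U) (γ : Γ) (r s : OSections Γ T U)
    (x : F.Sections U) : resLin h (act γ r s x) =
      act γ ((structureSheaf Γ T).obj.map (homOfLE h).op r)
        ((structureSheaf Γ T).obj.map (homOfLE h).op s) (resLin h x) :=
  F.res_act (homOfLE h) γ r s x

theorem resLin_self {U : Opens (specTop Γ T)} (h : U ≤ U) (x : F.Sections U) :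
    resLin h x = x :=
  ConcreteCategory.congr_hom (F.sheaf.obj.map_id (op U)) x

theorem resLin_resLin {U V W : Opens (specTop Γ T)} (h : V ≤ U) (h' : W ≤ V) (x : F.Sections U) :
    resLin h' (resLin h x) = resLin (h'.trans h) x :=
  (ConcreteCategory.congr_hom (F.sheaf.obj.map_comp (homOfLE h).op (homOfLE h').op) x).symm

theorem resLin_eq_mono {U U' V W : Opens (specTop Γ T)} {h : V ≤ U} {h' : V ≤ U'}
    {x : F.Sections U} {y : F.Sections U'} (e : resLin h x = resLin h' y) (hW : W ≤ V) :
    resLin (hW.trans h) x = resLin (hW.trans h') y := by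
  rw [← resLin_resLin h hW, e, resLin_resLin]

/-- The section `1 / b` of the structure sheaf provides the inverse. -/
theorem smul_bijective {U : Opens (specTop Γ T)} {b : Carr Γ T} (h : U ≤ basicOpen b) :
    Function.Bijective fun x : F.Sections U => b • x := by
  have h1 := OSections.const_mul_frac (T := T) b h
  refine Function.bijective_iff_has_inverse.2
    ⟨fun x => toCarr Γ (OSections.frac (T := T) 1 b h) • x, fun x => ?_, fun x => ?_⟩
  · beta_reduce
    rw [smul_eq_const_smul, smul_smul, mul_comm, h1, one_smul]
  · beta_reduce
    rw [smul_eq_const_smul, smul_smul, h1, one_smul]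

theorem eq_of_smul_eq {U : Opens (specTop Γ T)} {b : Carr Γ T} (h : U ≤ basicOpen b)
    {x y : F.Sections U} (e : b • x = b • y) : x = y :=
  (smul_bijective h).1 e

theorem eq_of_locally_eq {U : Opens (specTop Γ T)} {x y : F.Sections U}
    (H : ∀ P ∈ U, ∃ V : Opens (specTop Γ T), P ∈ V ∧ ∃ h : V ≤ U, resLin h x = resLin h y) :
    x = y := by
  choose V hP hV e using H
  refine F.sheaf.eq_of_locally_eq' (fun P : U => V P.1 P.2) U (fun P => homOfLE (hV P.1 P.2))
    (fun P hPU => Opens.mem_iSup.2 ⟨⟨P, hPU⟩, hP P hPU⟩) x y fun P => e P.1 P.2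

theorem exists_glue {ι : Type*} {U : Opens (specTop Γ T)} (V : ι → Opens (specTop Γ T))
    (hV : ∀ i, V i ≤ U) (hc : ∀ P ∈ U, ∃ i, P ∈ V i) (s : ∀ i, F.Sections (V i))
    (e : ∀ i j, resLin inf_le_left (s i) = resLin (inf_le_right : V i ⊓ V j ≤ V j) (s j)) :
    ∃ x : F.Sections U, ∀ i, resLin (hV i) x = s i := by
  obtain ⟨x, hx, -⟩ := F.sheaf.existsUnique_gluing' V U (fun i => homOfLE (hV i))
    (fun P hP => Opens.mem_iSup.2 (hc P hP)) s fun i j => e i j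
  exact ⟨x, hx⟩

end ModuleSheaf

open ModuleSheaf

/-! ### Sections of `M̃` -/

section Tilde

variable {M : GammaModuleCat Γ T} {U V : Opens (specTop Γ T)}

/-- The value `s(P) ∈ M_P` of a section of `M̃`. -/
def val (s : (tilde M).Sections U) (P : specTop Γ T) (hP : P ∈ U) :
    Loc (Spec.primeCompl P) M.carrier :=
  s.1 ⟨P, hP⟩

theorem tilde_ext {s t : (tilde M).Sections U} (h : ∀ P hP, val s P hP = val t P hP) : s = t :=
  TildeSections.ext fun P => h P.1 P.2

theorem val_smul {s : (tilde M).Sections U} {P : specTop Γ T} {hP : P ∈ U} {m : M.carrier}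
    {b : Carr Γ T} (h : IsFrac (val s P hP) m b) (a : Carr Γ T) :
    IsFrac (val (a • s) P hP) (a • m) b := by
  have h1 : IsFrac (P := P) (M := T)
    (Loc.mk (S := Spec.primeCompl P) (M := T) a ⟨_, P.one_notMem⟩) (a : T) (1 : Carr Γ T) := ⟨P.one_notMem, rfl⟩
  have h2 : IsFrac (P := P) (M := T)
    (Loc.mk (S := Spec.primeCompl P) (1 : T) ⟨_, P.one_notMem⟩) (1 : T) (1 : Carr Γ T) := ⟨P.one_notMem, rfl⟩
  have h3 := IsFrac.act (Classical.arbitrary Γ) h1 h2 h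
  rw [toCarr_one, mul_one, mul_one, one_mul] at h3
  exact h3

/-- If `s = m / b` on a neighbourhood containing `D(c)`, then `s = (c • m) / (c * b)` on `D(c * b)`.
Expanding the fraction lets one element serve both as denominator and as equation of the open set.
-/
theorem exists_basicOpen_isFrac (s : (tilde M).Sections U) {P : specTop Γ T} (hP : P ∈ U) :
    ∃ (h : Carr Γ T) (hU : basicOpen h ≤ U) (m : M.carrier), P ∈ basicOpen h ∧
      ∀ Q (hQ : Q ∈ basicOpen h), IsFrac (val s Q (hU hQ)) m h := by
  obtain ⟨V, hPV, hVU, m, b, H⟩ := module_pred_iff.1 s.2 ⟨P, hP⟩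
  obtain ⟨c, hPc, hc⟩ := exists_basicOpen_le hPV
  have hcb : basicOpen (c * toCarr Γ b) ≤ basicOpen c := by
    rw [basicOpen_mul]
    exact inf_le_left
  refine ⟨c * toCarr Γ b, (hcb.trans hc).trans hVU, c • m, ?_, fun Q hQ => ?_⟩
  · exact (P.mul_notMem_iff c (toCarr Γ b)).2 ⟨hPc, (H ⟨P, hPV⟩).1⟩
  · exact IsFrac.scale (H ⟨Q, hc (hcb hQ)⟩) (hcb hQ)

/-- The section `m / b` of `M̃`. -/
def tildeFrac (m : M.carrier) (b : Carr Γ T) (h : U ≤ basicOpen b) : (tilde M).Sections U :=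
  ⟨fun P => Loc.mk (S := Spec.primeCompl P.1) m ⟨b, h P.2⟩,
    module_pred_iff.2 fun P => ⟨U, P.2, le_rfl, m, b, fun Q => ⟨h Q.2, rfl⟩⟩⟩

theorem val_tildeFrac (m : M.carrier) (b : Carr Γ T) (h : U ≤ basicOpen b) (P : specTop Γ T)
    (hP : P ∈ U) : IsFrac (val (tildeFrac m b h) P hP) m b :=
  ⟨h hP, rfl⟩

end Tilde

/-! ### Sections of `M̃` over basic open sets -/

/-- The `u` with `u • m = u • n` form an ideal, the equalizer of two linear maps. The hypothesis
says that the `D(u)` cover `D(g)`, so this ideal contains a power of `g`. -/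
theorem exists_pow_smul_eq {M : Type v} [AddCommMonoid M] [GammaModule Γ T M] {m n : M}
    {g : Carr Γ T} (H : ∀ P : Spec Γ T, g ∉ P.carrier → ∃ u : Carr Γ T, u ∉ P.carrier ∧
      u • m = u • n) : ∃ k : ℕ, g ^ k • m = g ^ k • n := by
  let J : Ideal (Carr Γ T) := LinearMap.eqLocus (LinearMap.toSpanSingleton (Carr Γ T) M m)
    (LinearMap.toSpanSingleton (Carr Γ T) M n)
  obtain ⟨k, hk⟩ := Spec.exists_pow_mem_span (s := (J : Set (Carr Γ T))) (g := g)
    fun P hP => by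
      obtain ⟨u, hu, e⟩ := H P hP
      exact ⟨u, e, hu⟩
  rw [Ideal.span_eq] at hk
  exact ⟨k, hk⟩

/-- Exponents can be raised, so such equations hold for all large exponents, and finitely many of
them hold with a common one. -/
theorem pow_smul_eq_of_le {R : Type u} {M : Type v} [CommSemiring R] [AddCommMonoid M] [Module R M]
    {f : R} {x y : M} {k n : ℕ} (h : f ^ k • x = f ^ k • y) (hn : k ≤ n) :
    f ^ n • x = f ^ n • y := by
  obtain ⟨j, rfl⟩ := Nat.exists_eq_add_of_le' hn
  rw [pow_add, mul_smul, h, mul_smul]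

section Sections

variable {M N : GammaModuleCat Γ T} {U : Opens (specTop Γ T)}

/-- Partition of unity. Finitely many `D(h)` cover `D(g)`, with `s = k h / h` on `D(h)`. For a
common `n`, the elements `b • k a` and `a • k b` agree after multiplication by `(a * b) ^ n`.
Writing `g ^ N = ∑ c h * h ^ (n + 1)`, the numerator over `g ^ N` must be `∑ (c h * h ^ n) • k h`,
as `h • s = k h`. -/
theorem exists_isFrac_pow (s : (tilde M).Sections U) (g : Carr Γ T) (hU : U = basicOpen g) :
    ∃ (m : M.carrier) (n : ℕ), ∀ P hP, IsFrac (val s P hP) m (g ^ n) := by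
  subst hU
  obtain ⟨S, hS, hc⟩ := Spec.exists_finset_cover (g := g) (p := fun h => ∃ k : M.carrier,
      basicOpen h ≤ basicOpen g ∧ ∀ Q (_ : Q ∈ basicOpen h) (hQ : Q ∈ basicOpen g),
        IsFrac (val s Q hQ) k h) fun P hP => by
    obtain ⟨h, hU, k, hPh, H⟩ := exists_basicOpen_isFrac s hP
    exact ⟨h, ⟨k, hU, fun Q hQ _ => H Q hQ⟩, hPh⟩
  choose! k hk using hS
  have key : ∀ᶠ n : ℕ in Filter.atTop, ∀ x ∈ S ×ˢ S,
      (x.1 * x.2) ^ n • (x.2 • k x.1) = (x.1 * x.2) ^ n • (x.1 • k x.2) := by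
    rw [Filter.eventually_all_finset]
    rintro ⟨a, b⟩ hab
    obtain ⟨ha, hb⟩ := Finset.mem_product.1 hab
    obtain ⟨n, hn⟩ := exists_pow_smul_eq (m := b • k a) (n := a • k b) (g := a * b)
      fun P hP => by
        obtain ⟨hPa, hPb⟩ := (P.mul_notMem_iff a b).1 hP
        have hPg := (hk a ha).1 hPa
        obtain ⟨u, hu, e⟩ := (((hk a ha).2 P hPa hPg).eq_iff ((hk b hb).2 P hPb hPg)).1 rfl
        exact ⟨u, hu, by rw [smul_smul, smul_smul, e]⟩
    exact Filter.eventually_atTop.2 ⟨n, fun j hj => pow_smul_eq_of_le hn hj⟩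
  obtain ⟨n, hn⟩ := key.exists
  -- The exponent is `n + 1` because one factor `h` cancels the denominator of `k h / h`, and `h ^
  -- n` has to remain for the overlap equations.
  obtain ⟨N, hN⟩ := Spec.exists_pow_mem_span (s := (fun h => h ^ (n + 1)) '' (S : Set (Carr Γ T)))
    (g := g) fun P hP => by
      obtain ⟨h, hS, hPh⟩ := hc P hP
      exact ⟨_, ⟨h, hS, rfl⟩, P.pow_notMem hPh _⟩
  obtain ⟨c, hN⟩ := (Submodule.mem_span_image_finset_iff_exists_fun _).1 hN
  refine ⟨∑ i : S, (c i * i.1 ^ n) • k i.1, N, fun P hP => ?_⟩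
  obtain ⟨b, hb, hPb⟩ := hc P hP
  -- The factor `b ^ n` completes each `h ^ n` to `(h * b) ^ n`, so that the overlap equation for
  -- `h` and `b` applies to each summand.
  refine ((hk b hb).2 P hPb hP).of_eq (P.pow_notMem hP N) (P.pow_notMem hPb n) ?_
  rw [← hN, Finset.mul_sum, Finset.sum_smul, Finset.smul_sum]
  refine Finset.sum_congr rfl fun i _ => ?_
  have e := congrArg (fun x => c i • x) (hn (i.1, b) (Finset.mem_product.2 ⟨i.2, hb⟩))
  simp only [smul_smul] at e
  rw [smul_eq_mul, smul_smul]
  convert e.symm using 2 <;> ring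

/-- Trades a denominator for a scalar, which linear maps respect. -/
theorem isFrac_val_iff {s : (tilde M).Sections U} {P : specTop Γ T} {hP : P ∈ U} {m : M.carrier}
    {b : Carr Γ T} (hb : b ∉ P.carrier) :
    IsFrac (val s P hP) m b ↔ IsFrac (val (b • s) P hP) m 1 := by
  obtain ⟨k, c, h⟩ := IsFrac.exists_isFrac (val s P hP)
  constructor
  · intro h
    refine (val_smul h b).of_eq P.one_notMem_carr P.one_notMem_carr ?_
    rw [smul_smul, one_mul, one_mul]
  · intro h'
    obtain ⟨u, hu, e⟩ := ((val_smul h b).eq_iff h').1 rfl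
    refine h.of_eq hb hu ?_
    rwa [smul_smul, mul_one] at e

variable (M U) in
/-- The map `M → M̃(U)`, `m ↦ m / 1`. -/
def toTilde : M.carrier →ₗ[Carr Γ T] (tilde M).Sections U where
  toFun m := tildeFrac m 1 (le_top.trans basicOpen_one.ge)
  map_add' m n := tilde_ext fun P _ => (Loc.mk_add_mk_same (S := Spec.primeCompl P) m n _).symm
  map_smul' a m := tilde_ext fun P hP =>
    ((val_tildeFrac _ _ _ P hP).eq_iff (val_smul (val_tildeFrac m 1 _ P hP) a)).2
      ⟨1, P.one_notMem_carr, rfl⟩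

theorem val_toTilde (m : M.carrier) (P : specTop Γ T) (hP : P ∈ U) :
    IsFrac (val (toTilde M U m) P hP) m 1 :=
  val_tildeFrac m 1 (le_top.trans basicOpen_one.ge) P hP

theorem val_eq_of_isFrac {P : specTop Γ T} {z z' : Loc (Spec.primeCompl P) M.carrier}
    {m : M.carrier} {b : Carr Γ T} (h : IsFrac z m b) (h' : IsFrac z' m b) : z = z' := by
  obtain ⟨_, rfl⟩ := h
  obtain ⟨_, rfl⟩ := h'
  rfl

/-- This is the case `g = 1` of `exists_pow_smul_eq` and `exists_isFrac_pow`, where all powers of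
`g` are `1`. -/
theorem toTilde_bijective : Function.Bijective (toTilde M ⊤) := by
  constructor
  · intro m n h
    obtain ⟨k, hk⟩ := exists_pow_smul_eq (m := m) (n := n) (g := (1 : Carr Γ T)) fun P _ => by
      obtain ⟨u, hu, e⟩ := ((val_toTilde (U := ⊤) m P trivial).eq_iff
        (val_toTilde (U := ⊤) n P trivial)).1
        (by rw [h])
      exact ⟨u, hu, by rwa [mul_one] at e⟩
    simpa only [one_pow, one_smul] using hk
  · intro s
    obtain ⟨m, n, h⟩ := exists_isFrac_pow s 1 basicOpen_one.symm
    refine ⟨m, tilde_ext fun P hP => val_eq_of_isFrac (val_toTilde m P hP) ?_⟩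
    simpa only [one_pow] using h P hP

end Sections

/-! ### The functor is fully faithful -/

/-- An `𝒪(U)`-linear map, as a `T`-linear map. -/
def GammaModuleHom.sectionsLin {F G : ModuleSheaf Γ T} {U : Opens (specTop Γ T)}
    (e : GammaModuleHom Γ (OSections Γ T U) (F.Sections U) (G.Sections U)) :
    F.Sections U →ₗ[Carr Γ T] G.Sections U where
  toFun := e.toFun
  map_add' := e.map_add
  map_smul' _ x := e.map_act (Classical.arbitrary Γ) _ _ x

theorem val_tildeMap {M N : GammaModuleCat Γ T} (f : M ⟶ N) {U : Opens (specTop Γ T)}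
    {s : (tilde M).Sections U} {P : specTop Γ T} {hP : P ∈ U} {m : M.carrier} {b : Carr Γ T}
    (h : IsFrac (val s P hP) m b) :
    IsFrac (val (((tildeMap f).app U).toFun s) P hP) (GammaModuleHom.toFun f m) b :=
  IsFrac.mapHom f h

/-- The induced map sends the global section `m / 1` to `f(m) / 1`, which determines `f(m)`. -/
instance : (tildeFunctor Γ T).Faithful where
  map_injective {M N f g} h := by
    refine GammaModuleHom.ext (funext fun m => toTilde_bijective.1 (tilde_ext fun P hP => ?_))
    have hf := val_tildeMap f (val_toTilde (U := ⊤) m P hP)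
    have hg := val_tildeMap g (val_toTilde (U := ⊤) m P hP)
    change tildeMap f = tildeMap g at h
    rw [h] at hf
    exact ((val_toTilde _ P hP).eq_iff (val_toTilde _ P hP)).2
      ((hf.eq_iff hg).1 rfl)

/-- Let `f` be the map that `φ` induces on global sections. Near any point a section `s` satisfies
`h • s = m / 1` with `h` invertible there, so linearity and naturality force `φ(s) = f(m) / h`, the
value of the morphism induced by `f`. -/
instance : (tildeFunctor Γ T).Full where
  map_surjective {M N} φ := by
    let φ : ModuleSheaf.Hom (tilde M) (tilde N) := φ
    let e : N.carrier ≃ₗ[Carr Γ T] (tilde N).Sections ⊤ :=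
      LinearEquiv.ofBijective (toTilde N ⊤) toTilde_bijective
    let f : GammaModuleHom Γ T M.carrier N.carrier := GammaModuleHom.ofLinearMap
      (e.symm.toLinearMap ∘ₗ (φ.app ⊤).sectionsLin ∘ₗ toTilde M ⊤)
    have hf : ∀ m, toTilde N ⊤ (f.toFun m) = (φ.app ⊤).toFun (toTilde M ⊤ m) := fun m =>
      e.apply_symm_apply _
    refine ⟨f, ModuleSheaf.Hom.ext (funext fun U => GammaModuleHom.ext (funext fun s =>
      tilde_ext fun P hP => ?_))⟩
    obtain ⟨h, hU, m, hPh, H⟩ := exists_basicOpen_isFrac s hP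
    refine val_eq_of_isFrac (val_tildeMap f (H P hPh)) ((isFrac_val_iff hPh).2 ?_)
    have h1 : h • resLin hU s = resLin le_top (toTilde M ⊤ m) := tilde_ext fun Q hQ =>
      val_eq_of_isFrac ((isFrac_val_iff (s := resLin hU s) hQ).1 (H Q hQ)) (val_toTilde m Q hQ)
    have h2 : resLin hU (h • (φ.app U).toFun s) = resLin le_top (toTilde N ⊤ (f.toFun m)) := by
      rw [hf, map_smul]
      have := φ.naturality (homOfLE (le_top (a := basicOpen h))) (toTilde M ⊤ m)
      refine Eq.trans ?_ this
      change _ = (φ.app (basicOpen h)).toFun (resLin le_top (toTilde M ⊤ m))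
      rw [← h1]
      refine Eq.trans ?_ ((φ.app (basicOpen h)).sectionsLin.map_smul h (resLin hU s)).symm
      exact congrArg (h • ·) (φ.naturality (homOfLE hU) s).symm
    change IsFrac (val (resLin hU (h • (φ.app U).toFun s)) P hPh) _ _
    rw [h2]
    exact val_toTilde (U := ⊤) _ P trivial

/-! ### Sections of quasi-coherent sheaves over basic open sets -/

/-- Near `Q` let `s = m / a` and `t = k / b`. They agree on `D(a * b * f)`, so `b • m` and `a • k`
agree after multiplication by some `(a * b * f) ^ n`. On `D(a * b)` the factor `(a * b) ^ n` is
invertible, and only `f ^ n` is left. -/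
theorem tilde_exists_pow_smul_eq {M : GammaModuleCat Γ T} {V : Opens (specTop Γ T)}
    {s t : (tilde M).Sections V} {f : Carr Γ T}
    (e : resLin (inf_le_left : V ⊓ basicOpen f ≤ V) s = resLin inf_le_left t)
    {Q : specTop Γ T} (hQ : Q ∈ V) :
    ∃ h : Carr Γ T, Q ∈ basicOpen h ∧ ∃ (hV : basicOpen h ≤ V) (n : ℕ),
      resLin hV (f ^ n • s) = resLin hV (f ^ n • t) := by
  obtain ⟨a, haV, m, ha, hs⟩ := exists_basicOpen_isFrac s hQ
  obtain ⟨b, hbV, k, hb, ht⟩ := exists_basicOpen_isFrac t hQ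
  obtain ⟨n, hn⟩ := exists_pow_smul_eq (m := b • m) (n := a • k) (g := a * b * f) fun P hP => by
    obtain ⟨hP, hPf⟩ := (P.mul_notMem_iff _ _).1 hP
    obtain ⟨hPa, hPb⟩ := (P.mul_notMem_iff _ _).1 hP
    have h1 : val s P (haV hPa) = val t P (haV hPa) :=
      congrArg (fun z : (tilde M).Sections (V ⊓ basicOpen f) => val z P ⟨haV hPa, hPf⟩) e
    obtain ⟨u, hu, e⟩ := ((hs P hPa).eq_iff (ht P hPb)).1 h1
    exact ⟨u, hu, by rw [smul_smul, smul_smul, e]⟩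
  have hle : basicOpen (a * b) ≤ V := by
    rw [basicOpen_mul]
    exact inf_le_left.trans haV
  refine ⟨a * b, (Q.mul_notMem_iff _ _).2 ⟨ha, hb⟩, hle, n, tilde_ext fun P hP => ?_⟩
  obtain ⟨hPa, hPb⟩ := (P.mul_notMem_iff _ _).1 hP
  refine ((val_smul (hs P hPa) (f ^ n)).eq_iff (val_smul (ht P hPb) (f ^ n))).2
    ⟨(a * b) ^ n, P.pow_notMem hP n, ?_⟩
  simp only [smul_smul] at hn ⊢
  convert hn using 2 <;> ring

namespace IsQuasiCoherent

variable {F : ModuleSheaf Γ T}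

theorem exists_pow_smul_eq_locally (hF : IsQuasiCoherent Γ T F)
    {V : Opens (specTop Γ T)} {x y : F.Sections V} {f : Carr Γ T}
    (e : resLin (inf_le_left : V ⊓ basicOpen f ≤ V) x = resLin inf_le_left y)
    {Q : specTop Γ T} (hQ : Q ∈ V) :
    ∃ h : Carr Γ T, Q ∈ basicOpen h ∧ ∃ (hV : basicOpen h ≤ V) (n : ℕ),
      resLin hV (f ^ n • x) = resLin hV (f ^ n • y) := by
  obtain ⟨U, hU, M, φ, hbij, hnat⟩ := hF Q
  have nat : ∀ {V W : Opens (specTop Γ T)} (hV : V ≤ U) (hW : W ≤ V) (x : F.Sections V),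
      (φ W (hW.trans hV)).toFun (resLin hW x) = resLin hW ((φ V hV).toFun x) :=
    fun hV hW x => hnat hV (hW.trans hV) (homOfLE hW) x
  -- The local isomorphism exists only over `U`, so the statement for `M̃` is applied on `V ⊓ U`.
  have key : resLin (inf_le_left : V ⊓ U ⊓ basicOpen f ≤ V ⊓ U)
        ((φ (V ⊓ U) inf_le_right).toFun (resLin inf_le_left x)) =
      resLin inf_le_left ((φ (V ⊓ U) inf_le_right).toFun (resLin inf_le_left y)) := by
    rw [← nat, ← nat, resLin_resLin, resLin_resLin]
    exact congrArg _ (resLin_eq_mono e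
      (le_inf (inf_le_left.trans inf_le_left) inf_le_right : V ⊓ U ⊓ basicOpen f ≤ _))
  obtain ⟨h, hQh, hV, n, hn⟩ := tilde_exists_pow_smul_eq key ⟨hQ, hU⟩
  refine ⟨h, hQh, hV.trans inf_le_left, n, (hbij _ (hV.trans inf_le_right)).1 ?_⟩
  have aux : ∀ z : F.Sections V, (φ _ (hV.trans inf_le_right)).toFun
        (resLin (hV.trans inf_le_left) (f ^ n • z)) =
      resLin hV (f ^ n • (φ (V ⊓ U) inf_le_right).toFun (resLin inf_le_left z)) := by
    intro z
    rw [← resLin_resLin inf_le_left hV, nat inf_le_right hV, LinearMap.map_smul]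
    exact congrArg _ ((φ (V ⊓ U) inf_le_right).sectionsLin.map_smul _ _)
  rw [aux, aux, hn]

/-- Finitely many of the neighbourhoods in the local statement cover `D(g)`, and a large exponent
serves them all. `V` is only required to equal a basic open set, so that the lemma applies directly
to `⊤` and to `D(a) ⊓ D(b)`. -/
theorem eventually_pow_smul_eq (hF : IsQuasiCoherent Γ T F)
    {V : Opens (specTop Γ T)} {g : Carr Γ T} (hV : V = basicOpen g)
    {x y : F.Sections V} {f : Carr Γ T}
    (e : resLin (inf_le_left : V ⊓ basicOpen f ≤ V) x = resLin inf_le_left y) :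
    ∀ᶠ n : ℕ in Filter.atTop, f ^ n • x = f ^ n • y := by
  subst hV
  obtain ⟨S, hS, hc⟩ := Spec.exists_finset_cover (g := g)
    (p := fun h => ∃ (hV : basicOpen h ≤ basicOpen g) (n : ℕ),
      resLin hV (f ^ n • x) = resLin hV (f ^ n • y)) fun P hP => by
    obtain ⟨h, hPh, H⟩ := exists_pow_smul_eq_locally hF e hP
    exact ⟨h, H, hPh⟩
  have key : ∀ᶠ n : ℕ in Filter.atTop, ∀ h ∈ S, ∃ hV : basicOpen h ≤ basicOpen g,
      resLin hV (f ^ n • x) = resLin hV (f ^ n • y) := by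
    rw [Filter.eventually_all_finset]
    intro h hh
    obtain ⟨hV, n, hn⟩ := hS h hh
    refine Filter.eventually_atTop.2 ⟨n, fun j hj => ⟨hV, ?_⟩⟩
    rw [LinearMap.map_smul, LinearMap.map_smul] at hn ⊢
    exact pow_smul_eq_of_le hn hj
  filter_upwards [key] with n hn
  refine eq_of_locally_eq fun P hP => ?_
  obtain ⟨h, hS, hPh⟩ := hc P hP
  exact ⟨basicOpen h, hPh, hn h hS⟩

/-- On `D(h)` inside a set where `F` is some `M̃`, the section `t` over `D(h * f)` corresponds to a
single fraction `m / (h * f) ^ n`. Hence `f ^ n • t` is `m / h ^ n`, which makes sense on all of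
`D(h)`. -/
theorem exists_extend_locally (hF : IsQuasiCoherent Γ T F) {f : Carr Γ T}
    (t : F.Sections (basicOpen f)) (Q : specTop Γ T) :
    ∃ h : Carr Γ T, Q ∈ basicOpen h ∧ ∃ (n : ℕ) (y : F.Sections (basicOpen h)),
      resLin (inf_le_left : basicOpen h ⊓ basicOpen f ≤ _) y = f ^ n • resLin inf_le_right t := by
  obtain ⟨U, hU, M, φ, hbij, hnat⟩ := hF Q
  obtain ⟨h, hQ, hhU⟩ := exists_basicOpen_le hU
  let φ' := φ (basicOpen h ⊓ basicOpen f) (inf_le_left.trans hhU)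
  obtain ⟨m, n, hm⟩ := exists_isFrac_pow (φ'.toFun (resLin inf_le_right t)) (h * f)
    (basicOpen_mul h f).symm
  have hle : basicOpen h ≤ basicOpen (h ^ n) := fun P hP => P.pow_notMem hP n
  obtain ⟨y, hy⟩ := (hbij (basicOpen h) hhU).2 (tildeFrac m (h ^ n) hle)
  refine ⟨h, hQ, n, y, (hbij _ (inf_le_left.trans hhU)).1 ?_⟩
  refine (hnat hhU (inf_le_left.trans hhU) (homOfLE inf_le_left) y).trans ?_
  rw [hy]
  refine Eq.trans ?_ (φ'.sectionsLin.map_smul _ _).symm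
  refine tilde_ext fun P hP => ?_
  have h1 := val_tildeFrac m (h ^ n) hle P hP.1
  refine (h1.eq_iff (val_smul (hm P hP) (f ^ n))).2 ⟨1, P.one_notMem_carr, ?_⟩
  rw [smul_smul]
  congr 1
  ring

/-- Local extensions `y i` of `f ^ n • t` agree where `f` is invertible, but perhaps not on the full
overlaps. Multiplication by a further `f ^ k` makes them agree there, so the `f ^ k • y i` glue to
an extension of `f ^ (k + n) • t`. -/
theorem exists_extend (hF : IsQuasiCoherent Γ T F) {f : Carr Γ T} (t : F.Sections (basicOpen f)) :
    ∃ (n : ℕ) (x : F.Sections ⊤), resLin le_top x = f ^ n • t := by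
  obtain ⟨S, hS, hc⟩ := Spec.exists_finset_cover (g := (1 : Carr Γ T))
    (p := fun h => ∃ (n : ℕ) (y : F.Sections (basicOpen h)),
      resLin (inf_le_left : basicOpen h ⊓ basicOpen f ≤ _) y = f ^ n • resLin inf_le_right t)
    fun P _ => by
      obtain ⟨h, hPh, H⟩ := exists_extend_locally hF t P
      exact ⟨h, H, hPh⟩
  have key : ∀ᶠ n : ℕ in Filter.atTop, ∀ h ∈ S, ∃ y : F.Sections (basicOpen h),
      resLin (inf_le_left : basicOpen h ⊓ basicOpen f ≤ _) y = f ^ n • resLin inf_le_right t := by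
    rw [Filter.eventually_all_finset]
    intro h hh
    obtain ⟨n, y, hy⟩ := hS h hh
    refine Filter.eventually_atTop.2 ⟨n, fun j hj => ?_⟩
    obtain ⟨i, rfl⟩ := Nat.exists_eq_add_of_le' hj
    exact ⟨f ^ i • y, by rw [LinearMap.map_smul, hy, smul_smul, pow_add]⟩
  obtain ⟨n, hn⟩ := key.exists
  have hn' : ∀ i : S, ∃ y : F.Sections (basicOpen i.1),
      resLin (inf_le_left : basicOpen i.1 ⊓ basicOpen f ≤ _) y = f ^ n • resLin inf_le_right t :=
    fun i => hn i.1 i.2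
  choose y hy using hn'
  -- On `D(i) ⊓ D(j) ⊓ D(f)` both `y i` and `y j` are `f ^ n • t`. The overlap `D(i) ⊓ D(j)` is
  -- again basic.
  have key : ∀ᶠ k : ℕ in Filter.atTop, ∀ i j : S,
      f ^ k • resLin (inf_le_left : basicOpen i.1 ⊓ basicOpen j.1 ≤ _) (y i) =
        f ^ k • resLin inf_le_right (y j) := by
    rw [Filter.eventually_all]
    intro i
    rw [Filter.eventually_all]
    intro j
    refine eventually_pow_smul_eq hF (basicOpen_mul i.1 j.1).symm ?_
    rw [resLin_resLin, resLin_resLin]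
    have h1 : ∀ (l : S) (W : Opens (specTop Γ T)) (hl : W ≤ basicOpen l.1) (hf : W ≤ basicOpen f),
        resLin hl (y l) = f ^ n • resLin hf t := by
      intro l W hl hf
      rw [← resLin_resLin inf_le_left (le_inf hl hf), hy, LinearMap.map_smul, resLin_resLin]
    rw [h1 i _ _ inf_le_right, h1 j _ _ inf_le_right]
  obtain ⟨k, hk⟩ := key.exists
  obtain ⟨x, hx⟩ := exists_glue (F := F) (U := ⊤) (fun i : S => basicOpen i.1) (fun _ => le_top)
    (fun P _ => by
      obtain ⟨h, hS, hP⟩ := hc P P.one_notMem_carr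
      exact ⟨⟨h, hS⟩, hP⟩) (fun i => f ^ k • y i) fun i j => by
      rw [LinearMap.map_smul, LinearMap.map_smul, hk]
  refine ⟨k + n, x, eq_of_locally_eq fun P hP => ?_⟩
  obtain ⟨h, hS, hPh⟩ := hc P P.one_notMem_carr
  refine ⟨basicOpen h ⊓ basicOpen f, ⟨hPh, hP⟩, inf_le_right, ?_⟩
  have h2 := hx ⟨h, hS⟩
  rw [resLin_resLin, ← resLin_resLin le_top (inf_le_left : basicOpen h ⊓ basicOpen f ≤ _), h2,
    LinearMap.map_smul, hy ⟨h, hS⟩, LinearMap.map_smul, smul_smul, pow_add]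

/-- This and the next lemma identify the stalk of `F` at `P` with the localization of `F(⊤)` at `P`:
here injectivity, there surjectivity. -/
theorem exists_smul_eq_of_res_eq (hF : IsQuasiCoherent Γ T F)
    {W : Opens (specTop Γ T)} {m n : F.Sections ⊤}
    (e : resLin (le_top : W ≤ ⊤) m = resLin le_top n) {P : specTop Γ T} (hP : P ∈ W) :
    ∃ u : Carr Γ T, u ∉ P.carrier ∧ u • m = u • n := by
  obtain ⟨f, hPf, hf⟩ := exists_basicOpen_le hP
  obtain ⟨k, hk⟩ := (eventually_pow_smul_eq hF basicOpen_one.symm (f := f)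
    (resLin_eq_mono e (inf_le_right.trans hf))).exists
  exact ⟨f ^ k, P.pow_notMem hPf k, hk⟩

theorem exists_res_eq_smul (hF : IsQuasiCoherent Γ T F)
    {U : Opens (specTop Γ T)} (x : F.Sections U) {P : specTop Γ T} (hP : P ∈ U) :
    ∃ (m : F.Sections ⊤) (b : Carr Γ T) (W : Opens (specTop Γ T)) (hW : W ≤ U),
      P ∈ W ∧ W ≤ basicOpen b ∧ b • resLin hW x = resLin le_top m := by
  obtain ⟨f, hPf, hf⟩ := exists_basicOpen_le hP
  obtain ⟨n, m, h⟩ := exists_extend hF (resLin hf x)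
  exact ⟨m, f ^ n, basicOpen f, hf, hPf, fun Q hQ => Q.pow_notMem hQ n, h.symm⟩

end IsQuasiCoherent

/-! ### The isomorphism of a quasi-coherent sheaf with the sheaf of its global sections -/

namespace IsQuasiCoherent

variable {F : ModuleSheaf Γ T} {U V : Opens (specTop Γ T)}

variable (F) in
/-- The `Γ`-module of global sections. -/
abbrev globalSections : GammaModuleCat Γ T where
  carrier := F.Sections ⊤

/-- The fraction `m / b`, where `b x = m` near `P`. -/
def germ (hF : IsQuasiCoherent Γ T F) (x : F.Sections U) (P : specTop Γ T) (hP : P ∈ U) :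
    Loc (Spec.primeCompl P) (globalSections F).carrier :=
  Loc.mk (S := Spec.primeCompl P) (exists_res_eq_smul hF x hP).choose
    ⟨(exists_res_eq_smul hF x hP).choose_spec.choose, by
      obtain ⟨W, hW, hPW, hb, -⟩ := (exists_res_eq_smul hF x hP).choose_spec.choose_spec
      exact hb hPW⟩

/-- Independence of the choice in `germ`: for the chosen pair `m'`, `b'`, both `b • m'` and `b' • m`
restrict to `(b * b') • x` near `P`, hence agree after multiplication by some `u ∉ P`. All
properties of `germ` are deduced from this. -/
theorem isFrac_germ (hF : IsQuasiCoherent Γ T F) (x : F.Sections U) {P : specTop Γ T} (hP : P ∈ U)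
    {W : Opens (specTop Γ T)} (hPW : P ∈ W) (hW : W ≤ U) {m : F.Sections ⊤} {b : Carr Γ T}
    (hb : b ∉ P.carrier) (e : b • resLin hW x = resLin le_top m) :
    IsFrac (M := F.Sections ⊤) (germ hF x P hP) m b := by
  obtain ⟨W', hW', hPW', hb', e'⟩ := (exists_res_eq_smul hF x hP).choose_spec.choose_spec
  have h : IsFrac (M := F.Sections ⊤) (germ hF x P hP) (exists_res_eq_smul hF x hP).choose
    (exists_res_eq_smul hF x hP).choose_spec.choose := ⟨hb' hPW', rfl⟩
  generalize (exists_res_eq_smul hF x hP).choose_spec.choose = b' at hb' e' h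
  generalize (exists_res_eq_smul hF x hP).choose = m' at e' h
  rw [← LinearMap.map_smul] at e e'
  have e1 := resLin_eq_mono e (inf_le_left : W ⊓ W' ≤ W)
  have e1' := resLin_eq_mono e' (inf_le_right : W ⊓ W' ≤ W')
  obtain ⟨u, hu, hm⟩ := exists_smul_eq_of_res_eq hF (W := W ⊓ W') (m := b • m') (n := b' • m)
    (by rw [LinearMap.map_smul, LinearMap.map_smul, ← e1, ← e1', LinearMap.map_smul,
          LinearMap.map_smul, smul_comm]) ⟨hPW, hPW'⟩
  exact h.of_eq hb hu (by rwa [smul_smul, smul_smul] at hm)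

/-- One pair `m`, `b` computes the germs at all points near `P`. So the germs of `x` are locally a
fraction, as a section of `M̃` must be. -/
theorem exists_isFrac_germ (hF : IsQuasiCoherent Γ T F) (x : F.Sections U) {P : specTop Γ T}
    (hP : P ∈ U) : ∃ (m : F.Sections ⊤) (b : Carr Γ T) (W : Opens (specTop Γ T)) (hW : W ≤ U),
      P ∈ W ∧ b • resLin hW x = resLin le_top m ∧
      ∀ Q (hQ : Q ∈ W), IsFrac (M := F.Sections ⊤) (germ hF x Q (hW hQ)) m b := by
  obtain ⟨m, b, W, hW, hPW, hb, e⟩ := exists_res_eq_smul hF x hP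
  exact ⟨m, b, W, hW, hPW, e, fun Q hQ => isFrac_germ hF x (hW hQ) hQ hW (hb hQ) e⟩

theorem germ_res (hF : IsQuasiCoherent Γ T F) (h : V ≤ U) (x : F.Sections U) {P : specTop Γ T}
    (hP : P ∈ V) : germ hF (resLin h x) P hP = germ hF x P (h hP) := by
  obtain ⟨m, b, W, hW, hPW, e, H⟩ := exists_isFrac_germ hF (resLin h x) hP
  rw [resLin_resLin] at e
  exact val_eq_of_isFrac (M := globalSections F) (H P hPW)
    (isFrac_germ hF x (h hP) hPW (hW.trans h) (H P hPW).1 e)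

theorem germ_zero (hF : IsQuasiCoherent Γ T F) {P : specTop Γ T} (hP : P ∈ U) :
    germ hF (0 : F.Sections U) P hP = 0 :=
  val_eq_of_isFrac (M := globalSections F)
    (isFrac_germ hF 0 hP hP le_rfl (m := 0) P.one_notMem_carr (by
      rw [LinearMap.map_zero, LinearMap.map_zero, smul_zero])) IsFrac.zero

theorem germ_add (hF : IsQuasiCoherent Γ T F) (x y : F.Sections U) {P : specTop Γ T} (hP : P ∈ U) :
    germ hF (x + y) P hP = germ hF x P hP + germ hF y P hP := by
  obtain ⟨m, b, W, hW, hPW, e, H⟩ := exists_isFrac_germ hF x hP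
  obtain ⟨m', b', W', hW', hPW', e', H'⟩ := exists_isFrac_germ hF y hP
  rw [← LinearMap.map_smul] at e e'
  have e1 := resLin_eq_mono e (inf_le_left : W ⊓ W' ≤ W)
  have e1' := resLin_eq_mono e' (inf_le_right : W ⊓ W' ≤ W')
  have hb := (H P hPW).1
  have hb' := (H' P hPW').1
  have h := (H P hPW).scale hb'
  have h' := (H' P hPW').scale hb
  rw [mul_comm b b'] at h'
  refine val_eq_of_isFrac (M := globalSections F) (isFrac_germ hF (x + y) hP
    (W := W ⊓ W') ⟨hPW, hPW'⟩ (inf_le_left.trans hW) h.1 ?_) (h.add h')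
  simp only [LinearMap.map_add, LinearMap.map_smul, ← e1, ← e1', smul_smul, smul_add,
    mul_comm b b']

theorem germ_act (hF : IsQuasiCoherent Γ T F) (γ : Γ) (r s : OSections Γ T U) (x : F.Sections U)
    {P : specTop Γ T} (hP : P ∈ U) :
    germ hF (act γ r s x) P hP = act γ (r.1 ⟨P, hP⟩) (s.1 ⟨P, hP⟩) (germ hF x P hP) := by
  obtain ⟨m, b, W, hW, hPW, e, H⟩ := exists_isFrac_germ hF x hP
  obtain ⟨W₁, hPW₁, hW₁, a₁, c₁, h₁⟩ := fraction_pred_iff.1 r.2 ⟨P, hP⟩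
  obtain ⟨W₂, hPW₂, hW₂, a₂, c₂, h₂⟩ := fraction_pred_iff.1 s.2 ⟨P, hP⟩
  have hle : W₁ ⊓ W₂ ⊓ W ≤ U := inf_le_right.trans hW
  rw [← LinearMap.map_smul] at e
  have e1 := resLin_eq_mono e (inf_le_right : W₁ ⊓ W₂ ⊓ W ≤ W)
  rw [LinearMap.map_smul] at e1
  -- Clearing denominators in `r = a₁ / c₁` and `s = a₂ / c₂`; then `c₁ * c₂ * b` times `{r, s,
  -- x}_γ` is `(a₁ * a₂) • m`.
  have k₁ : toCarr Γ (OSections.const (T := T) _ (toCarr Γ c₁)) * _ =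
      toCarr Γ (OSections.const (T := T) _ (toCarr Γ a₁)) :=
    OSections.const_mul_eq (r := (structureSheaf Γ T).obj.map (homOfLE hle).op r)
      fun Q => h₁ ⟨Q.1, Q.2.1.1⟩
  have k₂ : toCarr Γ (OSections.const (T := T) _ (toCarr Γ c₂)) * _ =
      toCarr Γ (OSections.const (T := T) _ (toCarr Γ a₂)) :=
    OSections.const_mul_eq (r := (structureSheaf Γ T).obj.map (homOfLE hle).op s)
      fun Q => h₂ ⟨Q.1, Q.2.1.2⟩
  have h := IsFrac.act (M := F.Sections ⊤) γ (h₁ ⟨P, hPW₁⟩) (h₂ ⟨P, hPW₂⟩) (H P hPW)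
  refine val_eq_of_isFrac (M := globalSections F) (isFrac_germ hF _ hP (W := W₁ ⊓ W₂ ⊓ W)
    (b := toCarr Γ c₁ * toCarr Γ c₂ * b)
    ⟨⟨hPW₁, hPW₂⟩, hPW⟩ hle h.1 ?_) h
  rw [LinearMap.map_smul, ← e1, resLin_act, act_eq_toCarr_smul]
  simp only [smul_eq_const_smul, OSections.const_mul]
  rw [← k₁, ← k₂, smul_smul, smul_smul]
  congr 1
  ring

/-- Equality of `m / b` and `m' / b'` at `P` means `(u * b') • m = (u * b) • m'` for some `u ∉ P`.
Near `P` this reads `(u * b * b') • x = (u * b * b') • y`, and the scalar is invertible on a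
neighbourhood of `P`. -/
theorem germ_injective (hF : IsQuasiCoherent Γ T F) {x y : F.Sections U}
    (h : ∀ P hP, germ hF x P hP = germ hF y P hP) : x = y := by
  refine eq_of_locally_eq fun P hP => ?_
  obtain ⟨m, b, W, hW, hPW, e, H⟩ := exists_isFrac_germ hF x hP
  obtain ⟨m', b', W', hW', hPW', e', H'⟩ := exists_isFrac_germ hF y hP
  obtain ⟨u, hu, k⟩ := ((H P hPW).eq_iff (H' P hPW')).1 (h P hP)
  have hb := (H P hPW).1
  have hb' := (H' P hPW').1
  rw [← LinearMap.map_smul] at e e'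
  let W'' := basicOpen (u * b * b') ⊓ (W ⊓ W')
  have e1 := resLin_eq_mono e (inf_le_right.trans inf_le_left : W'' ≤ W)
  have e1' := resLin_eq_mono e' (inf_le_right.trans inf_le_right : W'' ≤ W')
  rw [LinearMap.map_smul] at e1 e1'
  refine ⟨W'', ⟨?_, hPW, hPW'⟩, inf_le_right.trans (inf_le_left.trans hW),
    eq_of_smul_eq (inf_le_left : W'' ≤ basicOpen (u * b * b')) ?_⟩
  · exact (P.mul_notMem_iff _ _).2 ⟨(P.mul_notMem_iff _ _).2 ⟨hu, hb⟩, hb'⟩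
  · have k' := congrArg (resLin (le_top : W'' ≤ ⊤)) k
    rw [LinearMap.map_smul, LinearMap.map_smul, ← e1, ← e1', smul_smul, smul_smul] at k'
    rwa [mul_right_comm u b' b] at k'

variable (F) in
/-- The morphism `F → M̃`, where `M` is the module of global sections of `F`. -/
def toTildeHom (hF : IsQuasiCoherent Γ T F) : ModuleSheaf.Hom F (tilde (globalSections F)) where
  app U :=
    { toFun := fun x => (⟨fun P => germ hF x P.1 P.2, module_pred_iff.2 fun P => by
        obtain ⟨m, b, W, hW, hPW, e, H⟩ := exists_isFrac_germ hF x P.2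
        exact ⟨W, hPW, hW, m, b, fun Q => H Q.1 Q.2⟩⟩ :
          TildeSections Γ T (globalSections F).carrier U)
      map_zero := TildeSections.ext fun P => germ_zero hF P.2
      map_add := fun x y => TildeSections.ext fun P => germ_add hF x y P.2
      map_act := fun γ r s x => TildeSections.ext fun P => germ_act hF γ r s x P.2 }
  naturality i x := TildeSections.ext fun P => germ_res hF i.le x P.2

theorem val_toTildeHom (hF : IsQuasiCoherent Γ T F) (x : F.Sections U) (P : specTop Γ T)
    (hP : P ∈ U) : val (((toTildeHom F hF).app U).toFun x) P hP = germ hF x P hP :=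
  rfl

/-- For surjectivity, if `s = m / h` on `D(h)`, then `h` acts bijectively on `F(D(h))`, and the
solution `x` of `h • x = m` has the germs of `s`. By injectivity these solutions agree on overlaps,
so they glue. -/
theorem toTildeHom_bijective (hF : IsQuasiCoherent Γ T F) (U : Opens (specTop Γ T)) :
    Function.Bijective ((toTildeHom F hF).app U).toFun := by
  constructor
  · intro x y h
    exact germ_injective hF fun P hP =>
      congrArg (fun z : (tilde (globalSections F)).Sections U => val z P hP) h
  · intro s
    have H : ∀ P : U, ∃ (h : Carr Γ T) (hU : basicOpen h ≤ U) (x : F.Sections (basicOpen h)),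
        P.1 ∈ basicOpen h ∧ ∀ Q (hQ : Q ∈ basicOpen h), germ hF x Q hQ = val s Q (hU hQ) := by
      rintro ⟨P, hP⟩
      obtain ⟨h, hU, m, hPh, H⟩ := exists_basicOpen_isFrac s hP
      obtain ⟨x, hx⟩ := (smul_bijective (le_refl (basicOpen h))).2
        (resLin (F := F) le_top m)
      refine ⟨h, hU, x, hPh, fun Q hQ => val_eq_of_isFrac (M := globalSections F)
        (isFrac_germ hF x hQ hQ le_rfl hQ ?_) (H Q hQ)⟩
      rw [resLin_self]
      exact hx
    choose h hU x hP hx using H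
    obtain ⟨y, hy⟩ := exists_glue (fun P => basicOpen (h P)) hU (fun P hPU => ⟨⟨P, hPU⟩, hP _⟩) x
      fun P Q => germ_injective hF fun R hR => by
        rw [germ_res, germ_res, hx, hx]
    refine ⟨y, tilde_ext fun P hPU => ?_⟩
    rw [val_toTildeHom, ← hx ⟨P, hPU⟩ P (hP _), ← hy, germ_res]

end IsQuasiCoherent

/-- A morphism that is bijective on sections is an isomorphism. -/
def ModuleSheaf.isoOfBijective {F G : ModuleSheaf Γ T} (f : ModuleSheaf.Hom F G)
    (h : ∀ U, Function.Bijective (f.app U).toFun) : F ≅ G :=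
  let e := fun U => Equiv.ofBijective _ (h U)
  { hom := f
    inv :=
      { app := fun U =>
          { toFun := (e U).symm
            map_zero := (e U).symm_apply_eq.2 (f.app U).map_zero.symm
            map_add := fun x y => (e U).symm_apply_eq.2 (by
              refine Eq.trans ?_ ((f.app U).map_add _ _).symm
              exact congrArg₂ (· + ·) ((e U).apply_symm_apply x).symm
                ((e U).apply_symm_apply y).symm)
            map_act := fun γ a b x => (e U).symm_apply_eq.2 (by
              refine Eq.trans ?_ ((f.app U).map_act γ a b _).symm
              exact congrArg (act γ a b) ((e U).apply_symm_apply x).symm) }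
        naturality := fun {U V} i x => (e V).symm_apply_eq.2 (by
          refine Eq.trans ?_ (f.naturality i _).symm
          exact congrArg (G.res i) ((e U).apply_symm_apply x).symm) }
    hom_inv_id := ModuleSheaf.Hom.ext (funext fun U => GammaModuleHom.ext
      (funext (e U).symm_apply_apply))
    inv_hom_id := ModuleSheaf.Hom.ext (funext fun U => GammaModuleHom.ext
      (funext (e U).apply_symm_apply)) }

/-! ### The equivalence with quasi-coherent sheaves -/

instance : (tildeQCoh Γ T).Faithful :=
  Functor.Faithful.of_comp_iso
    ((IsQuasiCoherent Γ T).liftCompιIso (tildeFunctor Γ T) tilde_isQuasiCoherent)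

instance : (tildeQCoh Γ T).Full :=
  Functor.Full.of_comp_faithful_iso
    ((IsQuasiCoherent Γ T).liftCompιIso (tildeFunctor Γ T) tilde_isQuasiCoherent)

/-- The preimage of `F` is its module of global sections. -/
instance : (tildeQCoh Γ T).EssSurj where
  mem_essImage F := ⟨IsQuasiCoherent.globalSections F.obj,
    ⟨(ObjectProperty.isoMk _ (ModuleSheaf.isoOfBijective _
      (IsQuasiCoherent.toTildeHom_bijective F.property))).symm⟩⟩

end GammaGeometry

end

theorem mainTheorem4 (Γ : Type w) [Nonempty Γ] (T : Type u) [AddCommMonoid T] [One T]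
    [GammaGeometry.CommTernaryGammaSemiring Γ T] :
    (GammaGeometry.tildeQCoh Γ T).IsEquivalence where
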